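/- For a positive integer $s$, an ordered chain forest of $[s]=\{1,\dots,s\}$ is an ordered partition $\mathcal F=\mathsf B_1\cdots\mathsf B_k$ of $[s]$ into nonempty blocks, each of which is itself linearly ordered. The leader of a block is its first element; the weight $\mathrm{wt}(\mathsf B)$ of a block is the number of its elements that are smaller than its leader; a sequence of blocks is naturally ordered if the leaders of its blocks increase. For an integer $\ell\ge 0$ put $$\gamma(\mathcal F,\ell)=\Bigl|\Bigl\{j\in[k] : \sum_{i=1}^{j}|\mathsf B_i|>\ell\Bigr\}\Bigr| .$$ For integers $a\le b+1$ and $n$ put $$\Pi^n_{a,b}=\sum_{a\le i_1<\cdots<i_n\le b} i_1\cdots i_n ,$$ where $\Pi^0_{a,b}=1$ (also when $b=a-1$) and $\Pi^n_{a,b}=0$ if $n<0$ or $n>b-a+1$. Let $\mathrm{CF}^1(q,s,k,\ell,m)$ be the set of ordered chain forests $\mathcal F=\mathsf B_1\cdots\mathsf B_{k-1}\mathsf C_1$ of $[s]$ with $k$ blocks and $\gamma(\mathcal F,\ell)=m\ge 2$ such that 1. $1\in\mathsf C_1$ and $1$ is the leader of $\mathsf C_1$; 2. $\sum_{i=1}^{k-1}\mathrm{wt}(\mathsf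 B_i)+|\mathsf C_1|=q$; 3. the blocks $\mathsf B_1,\dots,\mathsf B_{k-1}$ are naturally ordered; 4. the leader of the $(k-m+2)$-th block is in the $(\ell+2)$-th position of the word obtained by writing out the elements of the blocks of $\mathcal F$ in order. Theorem. Let $1\le m\le k\le s$, $q\ge 0$ and $0\le\ell\le s-1$ be integers. Then $$|\mathrm{CF}^1(q+1,s+1,k+1,\ell,m+1)|=\sum_{i=0}^{q}(-1)^i\binom{s}{i}\,\Pi^{s-\ell-m}_{-i,\,s-\ell-2-i}\,\Pi^{\ell-(k-m)}_{s-\ell-i,\,s-1-i}\binom{k-1+q-i}{k-1}.$$ In particular, the alternating sum on the right-hand side is nonnegative. -/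

import Mathlib

/-- An ordered chain forest of `[s] = {1, …, s}`: an ordered partition of `[s]` into nonempty blocks,
each block being itself internally ordered. The blocks are listed in order, and each block is the
list of its elements in order. -/
@[ext]
structure OrderedChainForest (s : ℕ) where
  blocks : List (List ℕ)
  nonempty_of_mem : ∀ B ∈ blocks, B ≠ []
  nodup : blocks.flatten.Nodup
  mem_iff : ∀ x, x ∈ blocks.flatten ↔ 1 ≤ x ∧ x ≤ s

namespace OrderedChainForest

/-- The leader of a block, that is, its first element. (The default value `0` only concerns the
empty list, which is never a block.) -/
def leader (B : List ℕ) : ℕ := B.headD 0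

/-- The weight of a block: the number of its elements that are less than its leader. -/
def wt (B : List ℕ) : ℕ := B.countP (fun x => decide (x < leader B))

/-- A sequence of blocks is naturally ordered if the leaders increase. -/
def NaturallyOrdered (Bs : List (List ℕ)) : Prop :=
  Bs.Pairwise (fun B B' => leader B < leader B')

variable {s : ℕ}

/-- The total number of elements of the first `j` blocks, `|B₁| + ⋯ + |B_j|`. -/
def partialSize (F : OrderedChainForest s) (j : ℕ) : ℕ :=
  ((F.blocks.take j).map List.length).sum

/-- `γ(F, ℓ)`: the number of `j ∈ {1, …, k}` with `|B₁| + ⋯ + |B_j| > ℓ`, where `k` is the number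
of blocks of `F`. -/
def gamma (F : OrderedChainForest s) (ℓ : ℕ) : ℕ :=
  ((Finset.Icc 1 F.blocks.length).filter (fun j => ℓ < F.partialSize j)).card

/-- The position (counted from `1`, in the word obtained by writing out all the blocks one after
another) of the leader of the `j`-th block, `1 ≤ j ≤ k`. -/
def leaderPosition (F : OrderedChainForest s) (j : ℕ) : ℕ :=
  F.partialSize (j - 1) + 1

/-- The set `CF¹(q, s, k, ℓ, m)` of ordered chain forests `B₁ ⋯ B_{k-1} C` of `[s]` with `k` blocks
and `γ(F, ℓ) = m ≥ 2`, such that `1` is the leader of the last block `C`, the weights of the `B_i`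
and the size of `C` add up to `q`, the `B_i` are naturally ordered, and the leader of the
`(k - m + 2)`-th block is in position `ℓ + 2`. (As `2 ≤ m = γ(F, ℓ) ≤ k`, the natural number
`k - m + 2` is between `2` and `k`.) -/
def CFOne (q s k ℓ m : ℕ) : Set (OrderedChainForest s) :=
  {F | F.blocks.length = k ∧ F.gamma ℓ = m ∧ 2 ≤ m ∧
    F.leaderPosition (k - m + 2) = ℓ + 2 ∧
    ∃ (Bs : List (List ℕ)) (C : List ℕ), F.blocks = Bs ++ [C] ∧
      1 ∈ C ∧ leader C = 1 ∧
      (Bs.map wt).sum + C.length = q ∧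
      NaturallyOrdered Bs}

/-- There are only finitely many ordered chain forests of `[s]`, so cardinalities of sets of them
are the true ones. -/
instance instFinite (s : ℕ) : Finite (OrderedChainForest s) := by
  have hfl : ∀ F : OrderedChainForest s, F.blocks.flatten.length ≤ s := by
    intro F
    have h := Finset.card_le_card (s := F.blocks.flatten.toFinset) (t := Finset.Icc 1 s)
      (by intro x hx; simpa [Finset.mem_Icc] using (F.mem_iff x).1 (List.mem_toFinset.1 hx))
    rw [List.toFinset_card_of_nodup F.nodup] at h
    simpa using h
  let S : Set (List ℕ) := {l | l.length ≤ s ∧ ∀ x ∈ l, x ∈ Set.Iic s}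
  have hS : S.Finite := by
    have := List.finite_length_le (Set.Iic s) s
    refine (this.image (List.map Subtype.val)).subset ?_
    rintro l ⟨hl, hx⟩
    exact ⟨l.pmap (fun x h => ⟨x, h⟩) hx, by simpa using hl, by simp [List.map_pmap]⟩
  have hT : {L : List (List ℕ) | L.length ≤ s ∧ ∀ l ∈ L, l ∈ S}.Finite := by
    have : Finite S := hS
    have := List.finite_length_le S s
    refine (this.image (List.map Subtype.val)).subset ?_
    rintro l ⟨hl, hx⟩
    exact ⟨l.pmap (fun x h => ⟨x, h⟩) hx, by simpa using hl, by simp [List.map_pmap]⟩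
  have hT' := hT.to_subtype
  refine Finite.of_injective
    (fun F : OrderedChainForest s =>
      (⟨F.blocks, ?_, ?_⟩ : {L : List (List ℕ) | L.length ≤ s ∧ ∀ l ∈ L, l ∈ S})) ?_
  · have h1 : F.blocks.length ≤ F.blocks.flatten.length := by
      rw [List.length_flatten]
      have := List.card_nsmul_le_sum (F.blocks.map List.length) 1 (by
        intro n hn
        obtain ⟨B, hB, rfl⟩ := List.mem_map.1 hn
        exact List.length_pos_iff.2 (F.nonempty_of_mem B hB))
      simpa using this
    exact h1.trans (hfl F)
  · intro l hl
    refine ⟨(List.Sublist.length_le (List.sublist_flatten_of_mem hl)).trans (hfl F), ?_⟩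
    intro x hx
    exact ((F.mem_iff x).1 (List.mem_flatten.2 ⟨l, hl, hx⟩)).2
  · intro F G h
    exact OrderedChainForest.ext (congrArg Subtype.val h)

end OrderedChainForest

/-- `Π^n_{a,b}`: the sum of all products `i₁ ⋯ i_n` with `a ≤ i₁ < ⋯ < i_n ≤ b`. It is `1` for
`n = 0` (also if the range is empty), and `0` if `n < 0` or `n > b - a + 1`. -/
noncomputable def sumProducts (n a b : ℤ) : ℤ :=
  if n < 0 then 0 else ∑ T ∈ (Finset.Icc a b).powersetCard n.toNat, ∏ x ∈ T, x

/-! Write `z^(n)` for the rising factorial. The position condition says that the first `k - m + 1`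
blocks have exactly `ℓ + 1` elements in total; the value of `γ` then follows. Deleting the label `1`
leaves a triple: those blocks, the remaining `m - 1` blocks `B_i`, and the non-leaders of the last
block. If the last block is given a leader `N` above all labels, each of its non-leaders lies below
its leader. So `q` becomes one statistic: the number of non-leaders smaller than their leader,
marked by `u`. Reading the last block before the remaining `B_i` turns a forest into a pair of
flagged words, the second of which starts under the leader `N`.

Let leaders weigh `(1 - u) y` in the first word and `(1 - u) x` in the second. The weight of each
label is then `1 - u` times that of "a leader, or a non-leader exceeding its leader", plus `u` times
that of "a non-leader, under any leader". By linearity (`total_linear`) labels can be split one at a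
time. A label of the second kind is deleted at the cost of counting its positions
(`total_cons_of_nonleader`). If all labels are of the first kind, adding them in increasing order
gives `y x^(c) (y + c + 1)^(ℓ)` with `c = s - ℓ - 1` (`total_of_increasing`). The recursion in the
number of unsplit labels is solved by `altSum`, because `z^(n) - (z - 1)^(n) = n z^(n - 1)`
(`altSum_succ`, `total_append`).

Taking the coefficient of `y^(k - m + 1) x^(m - 1)` turns the rising factorials into the sums `Π`,
and the other side into `(1 - u)^k` times the generating function of the forests. Division by `(1 -
u)^k` produces the last binomial coefficient. -/

namespace FlaggedWord

/-! ### Weights of single flagged words -/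

open List

variable {R : Type*} [CommRing R]

/-- The weight of a flagged word, read from left to right. A token `(x, true)` is a leader and a
token `(x, false)` is not; `c` is the current leader, `a` the last leader that was read, and
`k a` is the weight of what follows the word. Leaders have to increase. -/
def scan (f : ℕ → ℕ → R) (g : ℕ → R) : ℕ → ℕ → List (ℕ × Bool) → (ℕ → R) → R
  | _, a, [], k => k a
  | _, a, (x, true) :: w, k => if a < x then g x * scan f g x x w k else 0
  | c, a, (x, false) :: w, k => f x c * scan f g c a w k

theorem scan_append (f : ℕ → ℕ → R) (g : ℕ → R) (l : List ℕ) (w : List (ℕ × Bool)) (c a : ℕ)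
    (k : ℕ → R) :
    scan f g c a (l.map (fun x => (x, false)) ++ w) k =
      (l.map (fun x => f x c)).prod * scan f g c a w k := by
  induction l with
  | nil => simp
  | cons x l ih => simp [scan, ih, mul_assoc]

theorem scan_congr {f f' : ℕ → ℕ → R} {g g' : ℕ → R} {w : List (ℕ × Bool)}
    (hf : ∀ x ∈ w.map Prod.fst, f x = f' x) (hg : ∀ x ∈ w.map Prod.fst, g x = g' x)
    {k k' : ℕ → R} (hk : ∀ a, k a = k' a) (c a : ℕ) :
    scan f g c a w k = scan f' g' c a w k' := by
  induction w generalizing c a with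
  | nil => exact hk a
  | cons t w ih =>
    obtain ⟨x, b⟩ := t
    have hf' := hf x (by simp)
    have hg' := hg x (by simp)
    have ih' := ih (fun y hy => hf y (by simp at hy ⊢; tauto))
      (fun y hy => hg y (by simp at hy ⊢; tauto))
    cases b <;> simp [scan, hf', hg', ih']

theorem scan_linear_cont (f : ℕ → ℕ → R) (g : ℕ → R) (w : List (ℕ × Bool)) (α β : R)
    (k k' : ℕ → R) (c a : ℕ) :
    scan f g c a w (fun a => α * k a + β * k' a) =
      α * scan f g c a w k + β * scan f g c a w k' := by
  induction w generalizing c a with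
  | nil => rfl
  | cons t w ih =>
    obtain ⟨x, b⟩ := t
    cases b
    · simp only [scan, ih]; ring
    · simp only [scan, ih]; split_ifs <;> ring

theorem scan_mul_cont (f : ℕ → ℕ → R) (g : ℕ → R) (w : List (ℕ × Bool)) (α : R)
    (k : ℕ → R) (c a : ℕ) :
    scan f g c a w (fun a => α * k a) = α * scan f g c a w k := by
  simpa using scan_linear_cont f g w α 0 k k c a

/-- The weight depends linearly on the weights of a label that occurs exactly once. -/
theorem scan_linear {f f₁ f₂ : ℕ → ℕ → R} {g g₁ g₂ : ℕ → R} {e : ℕ} {α β : R}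
    {w : List (ℕ × Bool)} (hnd : (w.map Prod.fst).Nodup) (he : e ∈ w.map Prod.fst)
    (hf : ∀ c, f e c = α * f₁ e c + β * f₂ e c) (hg : g e = α * g₁ e + β * g₂ e)
    (hf₁ : ∀ x ≠ e, f x = f₁ x) (hf₂ : ∀ x ≠ e, f x = f₂ x)
    (hg₁ : ∀ x ≠ e, g x = g₁ x) (hg₂ : ∀ x ≠ e, g x = g₂ x)
    (k : ℕ → R) (c a : ℕ) :
    scan f g c a w k = α * scan f₁ g₁ c a w k + β * scan f₂ g₂ c a w k := by
  induction w generalizing c a with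
  | nil => simp at he
  | cons t w ih =>
    obtain ⟨x, b⟩ := t
    simp only [map_cons, nodup_cons, mem_cons] at hnd he
    by_cases hx : e = x
    · subst hx
      have key : ∀ y ∈ w.map Prod.fst, y ≠ e := fun y hy h => hnd.1 (h ▸ hy)
      have h1 := scan_congr (w := w) (fun y hy => hf₁ y (key y hy)) (fun y hy => hg₁ y (key y hy))
        (fun a => rfl : ∀ a, k a = k a)
      have h2 := scan_congr (w := w) (fun y hy => hf₂ y (key y hy)) (fun y hy => hg₂ y (key y hy))
        (fun a => rfl : ∀ a, k a = k a)
      cases b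
      · simp only [scan, hf, ← h1, ← h2]; ring
      · simp only [scan, hg, ← h1, ← h2]; split_ifs <;> ring
    · have ih' := ih hnd.2 (by tauto)
      cases b
      · simp only [scan, ih', ← hf₁ x (Ne.symm hx), ← hf₂ x (Ne.symm hx)]; ring
      · simp only [scan, ih', ← hg₁ x (Ne.symm hx), ← hg₂ x (Ne.symm hx)]; split_ifs <;> ring

/-! ### Insertion of one token -/

theorem sum_insert_leader_eq_zero (f : ℕ → ℕ → R) (g : ℕ → R) {e : ℕ} (he : g e = 0)
    (w : List (ℕ × Bool)) (k : ℕ → R) (c a : ℕ) :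
    ((permutations'Aux (e, true) w).map (fun w' => scan f g c a w' k)).sum = 0 := by
  induction w generalizing c a with
  | nil => simp [scan, he]
  | cons t w ih =>
    obtain ⟨x, b⟩ := t
    have h2 : ∀ (s : R) (c a : ℕ), ((permutations'Aux (e, true) w).map
        (fun w' => s * scan f g c a w' k)).sum = 0 := by
      intro s c a
      rw [List.sum_map_mul_left, ih, mul_zero]
    cases b
    · simp [scan, he, Function.comp_def, h2]
    · by_cases hax : a < x <;> simp [scan, he, Function.comp_def, h2, hax]

/-- Inserting a non-leader that has weight `1` under every leader. -/
theorem sum_insert_nonleader (f : ℕ → ℕ → R) (g : ℕ → R) {e : ℕ} {c : ℕ}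
    (w : List (ℕ × Bool)) (he : ∀ c', c' = c ∨ c' ∈ w.map Prod.fst → 0 < c' → f e c' = 1)
    (hc : 0 < c) (k : ℕ → R) (a : ℕ) :
    ((permutations'Aux (e, false) w).map (fun w' => scan f g c a w' k)).sum =
      (w.length + 1) * scan f g c a w k := by
  induction w generalizing c a with
  | nil => simp [scan, he c (Or.inl rfl) hc]
  | cons t w ih =>
    obtain ⟨x, b⟩ := t
    have hec := he c (Or.inl rfl) hc
    cases b
    · have ih' := ih (c := c) (fun c' h => he c' (by simp at h ⊢; tauto)) hc
      simp only [permutations'Aux, map_cons, map_map, Function.comp_def, scan, sum_cons, hec,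
        length_cons, List.sum_map_mul_left, ih']
      push_cast; ring
    · by_cases hax : a < x
      · have ih' := ih (c := x) (fun c' h => he c' (by simp at h ⊢; tauto)) (by omega)
        simp only [permutations'Aux, map_cons, map_map, Function.comp_def, scan, sum_cons, hec,
          length_cons, List.sum_map_mul_left, ih', if_pos hax]
        push_cast; ring
      · simp [permutations'Aux, Function.comp_def, scan, hax]

/-- Inserting a non-leader that has weight `1` under every leader, into a word that begins in a
state where non-leaders have weight `0`. -/
theorem sum_insert_nonleader_of_start (f : ℕ → ℕ → R) (g : ℕ → R) {e : ℕ} {c : ℕ}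
    (w : List (ℕ × Bool)) (he : ∀ c' ∈ w.map Prod.fst, 0 < c' → f e c' = 1)
    (hec : f e c = 0) (hc : ∀ x ∈ w.map Prod.fst, f x c = 0) (k : ℕ → R) (a : ℕ) :
    ((permutations'Aux (e, false) w).map (fun w' => scan f g c a w' k)).sum =
      w.length * scan f g c a w k := by
  cases w with
  | nil => simp [scan, hec]
  | cons t w =>
    obtain ⟨x, b⟩ := t
    cases b
    -- The word starts with a non-leader of weight `0`, and so does every word obtained by
    -- insertion.
    · have := hc x (by simp)
      simp [permutations'Aux, Function.comp_def, scan, hec, this]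
    · by_cases hax : a < x
      · have := sum_insert_nonleader f g (e := e) (c := x) w
          (fun c' h => he c' (by simp at h ⊢; tauto)) (by omega) k x
        simp [permutations'Aux, Function.comp_def, scan, hec, hax, List.sum_map_mul_left, this]
        ring
      · simp [permutations'Aux, Function.comp_def, scan, hax, hec]

/-- The first token already kills the weight: as a non-leader it weighs `0` under `c`, as a leader
it fails to exceed `a`. -/
theorem scan_eq_zero_of_lt (f : ℕ → ℕ → R) (g : ℕ → R) {c a : ℕ} {w : List (ℕ × Bool)}
    (hw : w ≠ []) (hc : ∀ x ∈ w.map Prod.fst, f x c = 0) (ha : ∀ x ∈ w.map Prod.fst, x ≤ a)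
    (k : ℕ → R) : scan f g c a w k = 0 := by
  cases w with
  | nil => exact absurd rfl hw
  | cons t w =>
    obtain ⟨x, b⟩ := t
    cases b
    · simp [scan, hc x (by simp)]
    · have := ha x (by simp)
      simp [scan]; omega

/-- A leader that exceeds all labels can only be inserted at the end. -/
theorem sum_insert_leader (f : ℕ → ℕ → R) (g : ℕ → R) {e : ℕ} {c a : ℕ}
    (w : List (ℕ × Bool)) (hf : ∀ x ∈ w.map Prod.fst, f x e = 0)
    (he : ∀ x ∈ w.map Prod.fst, x < e) (ha : a < e) (k : ℕ → R) :
    ((permutations'Aux (e, true) w).map (fun w' => scan f g c a w' k)).sum =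
      scan f g c a w (fun _ => g e * k e) := by
  induction w generalizing c a with
  | nil => simp [scan, ha]
  | cons t w ih =>
    obtain ⟨x, b⟩ := t
    have h0 : scan f g e e ((x, b) :: w) k = 0 :=
      scan_eq_zero_of_lt f g (by simp) hf (fun y hy => (he y hy).le) k
    have hf' : ∀ y ∈ w.map Prod.fst, f y e = 0 := fun y h => hf y (by simp at h ⊢; tauto)
    have he' : ∀ y ∈ w.map Prod.fst, y < e := fun y h => he y (by simp at h ⊢; tauto)
    have hx : x < e := he x (by simp)
    have h1 : scan f g c a ((e, true) :: (x, b) :: w) k = 0 := by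
      rw [scan, h0]; simp
    rw [permutations'Aux, map_cons, sum_cons, h1, zero_add, map_map]
    cases b
    · simp only [Function.comp_def, scan, List.sum_map_mul_left, ih hf' he' ha]
    · by_cases hax : a < x
      · simp only [Function.comp_def, scan, if_pos hax, List.sum_map_mul_left, ih hf' he' hx]
      · simp [Function.comp_def, scan, hax]

/-! ### Pairs of flagged words over a list of labels -/

/-- All ways to insert the label `e`, as a leader or not. -/
def insertions (e : ℕ) (w : List (ℕ × Bool)) : List (List (ℕ × Bool)) :=
  permutations'Aux (e, true) w ++ permutations'Aux (e, false) w

/-- All pairs of flagged words that together use each label of a list once. -/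
def wordPairs : List ℕ → List (List (ℕ × Bool) × List (ℕ × Bool))
  | [] => [([], [])]
  | e :: L => (wordPairs L).flatMap fun p =>
      (insertions e p.1).map (fun w => (w, p.2)) ++ (insertions e p.2).map (fun w => (p.1, w))

theorem mem_permutations'Aux_iff {α : Type*} {t : α} {s w : List α} :
    w ∈ permutations'Aux t s ↔ ∃ l₁ l₂, s = l₁ ++ l₂ ∧ w = l₁ ++ t :: l₂ := by
  induction s generalizing w with
  | nil => simp
  | cons y s ih =>
    simp only [permutations'Aux, mem_cons, mem_map, ih]
    constructor
    · rintro (rfl | ⟨_, ⟨l₁, l₂, rfl, rfl⟩, rfl⟩)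
      · exact ⟨[], _, rfl, rfl⟩
      · exact ⟨y :: l₁, l₂, rfl, rfl⟩
    · rintro ⟨l₁, l₂, h, rfl⟩
      cases l₁ with
      | nil => left; simp at h ⊢; exact h.symm
      | cons z l₁ =>
        simp only [cons_append, cons.injEq] at h
        right
        exact ⟨l₁ ++ t :: l₂, ⟨l₁, l₂, h.2, rfl⟩, by simp [h.1]⟩

theorem mem_insertions_iff {e : ℕ} {s w : List (ℕ × Bool)} :
    w ∈ insertions e s ↔ ∃ b l₁ l₂, s = l₁ ++ l₂ ∧ w = l₁ ++ (e, b) :: l₂ := by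
  simp [insertions, mem_permutations'Aux_iff, or_comm]

theorem length_of_mem_insertions {e : ℕ} {s w : List (ℕ × Bool)} (h : w ∈ insertions e s) :
    w.length = s.length + 1 := by
  obtain ⟨b, l₁, l₂, rfl, rfl⟩ := mem_insertions_iff.1 h
  simp; omega

theorem mem_wordPairs_iff {L : List ℕ} {p : List (ℕ × Bool) × List (ℕ × Bool)} :
    p ∈ wordPairs L ↔ ((p.1 ++ p.2).map Prod.fst).Perm L := by
  induction L generalizing p with
  | nil =>
    obtain ⟨w₁, w₂⟩ := p
    simp [wordPairs]
  | cons e L ih =>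
    obtain ⟨w₁, w₂⟩ := p
    simp only [wordPairs, mem_flatMap, mem_append, mem_map, mem_insertions_iff, Prod.mk.injEq,
      Prod.exists, ih]
    constructor
    · rintro ⟨v₁, v₂, h, (⟨_, ⟨b, l₁, l₂, rfl, rfl⟩, rfl, rfl⟩ | ⟨_, ⟨b, l₁, l₂, rfl, rfl⟩, rfl, rfl⟩)⟩
      · have := h.cons e
        refine Perm.trans ?_ this
        simp only [map_append, map_cons, append_assoc, cons_append]
        exact perm_middle
      · have := h.cons e
        refine Perm.trans ?_ this
        simp only [map_append, map_cons, ← append_assoc]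
        exact perm_middle
    · intro h
      have he : e ∈ (w₁ ++ w₂).map Prod.fst := h.mem_iff.2 (by simp)
      simp only [map_append, mem_append, mem_map, Prod.exists, exists_and_right,
        exists_eq_right] at he
      rcases he with ⟨b, hb⟩ | ⟨b, hb⟩
      · obtain ⟨l₁, l₂, rfl⟩ := append_of_mem hb
        refine ⟨l₁ ++ l₂, w₂, ?_, Or.inl ⟨_, ⟨b, l₁, l₂, rfl, rfl⟩, rfl, rfl⟩⟩
        refine Perm.cons_inv (a := e) (Perm.trans ?_ h)
        simp only [map_append, map_cons, append_assoc, cons_append]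
        exact perm_middle.symm
      · obtain ⟨l₁, l₂, rfl⟩ := append_of_mem hb
        refine ⟨w₁, l₁ ++ l₂, ?_, Or.inr ⟨_, ⟨b, l₁, l₂, rfl, rfl⟩, rfl, rfl⟩⟩
        refine Perm.cons_inv (a := e) (Perm.trans ?_ h)
        simp only [map_append, map_cons, ← append_assoc]
        exact perm_middle.symm

theorem nodup_insertions {e : ℕ} {w : List (ℕ × Bool)} (he : e ∉ w.map Prod.fst) :
    (insertions e w).Nodup := by
  have h : ∀ b, (e, b) ∉ w := fun b hb => he (mem_map.2 ⟨_, hb, rfl⟩)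
  refine nodup_append.2 ⟨nodup_permutations'Aux_of_notMem _ _ (h _),
    nodup_permutations'Aux_of_notMem _ _ (h _), ?_⟩
  rintro a ha _ hb rfl
  obtain ⟨l₁, l₂, rfl, rfl⟩ := mem_permutations'Aux_iff.1 ha
  obtain ⟨l₃, l₄, hl, hl'⟩ := mem_permutations'Aux_iff.1 hb
  have : (e, true) ∈ l₃ ++ (e, false) :: l₄ := hl' ▸ by simp
  refine h true (hl ▸ ?_)
  simpa using this

theorem filter_insertions {e : ℕ} {w w' : List (ℕ × Bool)} (he : e ∉ w.map Prod.fst)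
    (hw' : w' ∈ insertions e w) : w'.filter (fun t => t.1 ≠ e) = w := by
  obtain ⟨b, l₁, l₂, rfl, rfl⟩ := mem_insertions_iff.1 hw'
  have h : ∀ t ∈ l₁ ++ l₂, t.1 ≠ e := fun t ht h => he (mem_map.2 ⟨t, ht, h⟩)
  have := filter_eq_self.2 (fun t ht => decide_eq_true (h t ht))
  simpa using this

/-- Deleting `e` from both words recovers the pair it was inserted into, so different pairs have
disjoint sets of insertions. -/
theorem nodup_wordPairs {L : List ℕ} (hL : L.Nodup) : (wordPairs L).Nodup := by
  induction L with
  | nil => simp [wordPairs]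
  | cons e L ih =>
    rw [nodup_cons] at hL
    have hp : ∀ p ∈ wordPairs L, e ∉ p.1.map Prod.fst ∧ e ∉ p.2.map Prod.fst := by
      intro p hp
      have := (mem_wordPairs_iff.1 hp).mem_iff (a := e)
      simp only [map_append, mem_append] at this
      tauto
    refine nodup_flatMap.2 ⟨fun p hpm => ?_, ?_⟩
    · obtain ⟨h1, h2⟩ := hp p hpm
      refine nodup_append.2 ⟨(nodup_insertions h1).map (fun _ _ h => (Prod.ext_iff.1 h).1),
        (nodup_insertions h2).map (fun _ _ h => (Prod.ext_iff.1 h).2), ?_⟩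
      rintro a ha _ hb rfl
      obtain ⟨w, hw, rfl⟩ := mem_map.1 ha
      obtain ⟨w', hw', h⟩ := mem_map.1 hb
      -- Insertion into the first word lengthens it; insertion into the second does not.
      have h3 := (Prod.ext_iff.1 h).1
      have h4 := length_of_mem_insertions hw
      simp only at h3
      rw [h3] at h4
      omega
    · refine (ih hL.2).imp_of_mem ?_
      intro p q hpm hqm hpq
      have key : ∀ p ∈ wordPairs L, ∀ r ∈ (insertions e p.1).map (fun w => (w, p.2)) ++
          (insertions e p.2).map (fun w => (p.1, w)),
          (r.1.filter (fun t => t.1 ≠ e), r.2.filter (fun t => t.1 ≠ e)) = p := by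
        intro p hpm r hr
        obtain ⟨h1, h2⟩ := hp p hpm
        have hs : ∀ w : List (ℕ × Bool), e ∉ w.map Prod.fst →
            w.filter (fun t => t.1 ≠ e) = w := by
          intro w hw
          exact filter_eq_self.2 (fun t ht => decide_eq_true
            (fun h => hw (mem_map.2 ⟨t, ht, h⟩)))
        rcases mem_append.1 hr with hr | hr <;> obtain ⟨w, hw, rfl⟩ := mem_map.1 hr
        · simp only [filter_insertions h1 hw, hs _ h2]
        · simp only [filter_insertions h2 hw, hs _ h1]
      intro r hr hr'
      exact hpq ((key p hpm r hr).symm.trans (key q hqm r hr'))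

/-- Lets any label be moved to the front of the list and removed first. -/
theorem wordPairs_perm {L L' : List ℕ} (hL : L.Nodup) (h : L.Perm L') :
    (wordPairs L).Perm (wordPairs L') := by
  refine (perm_ext_iff_of_nodup (nodup_wordPairs hL) (nodup_wordPairs (h.nodup_iff.1 hL))).2 ?_
  intro p
  rw [mem_wordPairs_iff, mem_wordPairs_iff]
  exact ⟨fun h' => h'.trans h, fun h' => h'.trans h.symm⟩

/-! ### Total weights of pairs, and removal of one label -/

theorem scan_congr_cont (f : ℕ → ℕ → R) (g : ℕ → R) {w : List (ℕ × Bool)} {k k' : ℕ → R}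
    {c a : ℕ} (hk : ∀ b, b = a ∨ b ∈ w.map Prod.fst → k b = k' b) :
    scan f g c a w k = scan f g c a w k' := by
  induction w generalizing c a with
  | nil => exact hk a (Or.inl rfl)
  | cons t w ih =>
    obtain ⟨x, b⟩ := t
    cases b
    · simp only [scan]
      rw [ih (fun b hb => hk b (by simp at hb ⊢; tauto))]
    · simp only [scan]
      rw [ih (fun b hb => hk b (by simp at hb ⊢; tauto))]

/-- Needed for insertions into the second word, which is scanned inside the continuation of the
first. -/
theorem scan_list_sum (f : ℕ → ℕ → R) (g : ℕ → R) (w : List (ℕ × Bool)) {ι : Type*} (l : List ι)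
    (F : ι → ℕ → R) (c a : ℕ) :
    (l.map (fun i => scan f g c a w (F i))).sum =
      scan f g c a w (fun b => (l.map (fun i => F i b)).sum) := by
  induction l with
  | nil => simpa using (scan_mul_cont f g w 0 (fun _ => 0) c a).symm
  | cons i l ih =>
    have := scan_linear_cont f g w 1 1 (F i) (fun b => (l.map (fun i => F i b)).sum) c a
    simp only [one_mul] at this
    simp only [map_cons, sum_cons, ih, this]

/-- The weight of a pair of flagged words: leaders have weight `g` in the first and `h` in the
second word; the second word starts with leader `N`, and the leaders of both words together have
to increase. -/
def pairWeight (f : ℕ → ℕ → R) (g h : ℕ → R) (N : ℕ) (p : List (ℕ × Bool) × List (ℕ × Bool)) : R :=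
  scan f g 0 0 p.1 (fun a => scan f h N a p.2 (fun _ => 1))

/-- The total weight of all pairs of flagged words over `L` whose first word has length `a`. -/
def total (f : ℕ → ℕ → R) (g h : ℕ → R) (N : ℕ) (L : List ℕ) (a : ℕ) : R :=
  ((wordPairs L).map (fun p => if p.1.length = a then pairWeight f g h N p else 0)).sum

theorem total_perm (f : ℕ → ℕ → R) (g h : ℕ → R) (N : ℕ) {L L' : List ℕ} (hL : L.Nodup)
    (hp : L.Perm L') (a : ℕ) : total f g h N L a = total f g h N L' a :=
  ((wordPairs_perm hL hp).map _).sum_eq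

theorem length_add_length_of_mem_wordPairs {L : List ℕ} {p : List (ℕ × Bool) × List (ℕ × Bool)}
    (hp : p ∈ wordPairs L) : p.1.length + p.2.length = L.length := by
  simpa using (mem_wordPairs_iff.1 hp).length_eq

/-- The label `e` occurs once in exactly one of the two words, so each pair weight is linear in the
weights of `e`; the other word does not see the change. -/
theorem total_linear {f f₁ f₂ : ℕ → ℕ → R} {g g₁ g₂ h h₁ h₂ : ℕ → R} {N e : ℕ} {α β : R}
    {L : List ℕ} (hL : L.Nodup) (he : e ∈ L)
    (hf : ∀ c, f e c = α * f₁ e c + β * f₂ e c) (hg : g e = α * g₁ e + β * g₂ e)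
    (hh : h e = α * h₁ e + β * h₂ e)
    (hf₁ : ∀ x ≠ e, f x = f₁ x) (hf₂ : ∀ x ≠ e, f x = f₂ x)
    (hg₁ : ∀ x ≠ e, g x = g₁ x) (hg₂ : ∀ x ≠ e, g x = g₂ x)
    (hh₁ : ∀ x ≠ e, h x = h₁ x) (hh₂ : ∀ x ≠ e, h x = h₂ x) (a : ℕ) :
    total f g h N L a = α * total f₁ g₁ h₁ N L a + β * total f₂ g₂ h₂ N L a := by
  have key : ∀ p ∈ wordPairs L, pairWeight f g h N p =
      α * pairWeight f₁ g₁ h₁ N p + β * pairWeight f₂ g₂ h₂ N p := by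
    intro p hp
    have hperm := mem_wordPairs_iff.1 hp
    have hnd := hperm.nodup_iff.2 hL
    have hm := hperm.mem_iff.2 he
    rw [map_append] at hnd hm
    obtain ⟨hn1, hn2, hn3⟩ := nodup_append.1 hnd
    have hne : ∀ l : List ℕ, e ∉ l → ∀ x ∈ l, x ≠ e := fun l hl x hx h => hl (h ▸ hx)
    unfold pairWeight
    rcases mem_append.1 hm with hm | hm
    · have h2 : ∀ x ∈ p.2.map Prod.fst, x ≠ e := fun x hx h => hn3 e hm x hx h.symm
      have c1 : ∀ b, scan f h N b p.2 (fun _ => 1) = scan f₁ h₁ N b p.2 (fun _ => 1) := fun b =>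
        scan_congr (fun x hx => hf₁ x (h2 x hx)) (fun x hx => hh₁ x (h2 x hx)) (fun _ => rfl) _ _
      have c2 : ∀ b, scan f h N b p.2 (fun _ => 1) = scan f₂ h₂ N b p.2 (fun _ => 1) := fun b =>
        scan_congr (fun x hx => hf₂ x (h2 x hx)) (fun x hx => hh₂ x (h2 x hx)) (fun _ => rfl) _ _
      rw [scan_linear hn1 hm hf hg hf₁ hf₂ hg₁ hg₂]
      simp only [c1]
      simp only [← c1, c2]
    · have h1 : ∀ x ∈ p.1.map Prod.fst, x ≠ e := fun x hx h => hn3 x hx e hm h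
      simp only [scan_linear hn2 hm hf hh hf₁ hf₂ hh₁ hh₂]
      rw [scan_linear_cont]
      congr 2
      · exact scan_congr (fun x hx => hf₁ x (h1 x hx)) (fun x hx => hg₁ x (h1 x hx))
          (fun _ => rfl) _ _
      · exact scan_congr (fun x hx => hf₂ x (h1 x hx)) (fun x hx => hg₂ x (h1 x hx))
          (fun _ => rfl) _ _
  unfold total
  rw [← List.sum_map_mul_left, ← List.sum_map_mul_left, ← List.sum_map_add]
  congr 1
  refine map_congr_left fun p hp => ?_
  split_ifs
  · exact key p hp
  · simp

theorem total_cons (f : ℕ → ℕ → R) (g h : ℕ → R) (N e : ℕ) (L : List ℕ) (a : ℕ) :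
    total f g h N (e :: L) a = ((wordPairs L).map (fun p =>
      (if p.1.length + 1 = a then
        ((insertions e p.1).map (fun w => pairWeight f g h N (w, p.2))).sum else 0) +
      (if p.1.length = a then
        ((insertions e p.2).map (fun w => pairWeight f g h N (p.1, w))).sum else 0))).sum := by
  have hsum : ∀ (l : List (List (ℕ × Bool) × List (ℕ × Bool)))
      (F : List (ℕ × Bool) × List (ℕ × Bool) → List (List (ℕ × Bool) × List (ℕ × Bool)))
      (G : List (ℕ × Bool) × List (ℕ × Bool) → R),
      ((l.flatMap F).map G).sum = (l.map (fun p => ((F p).map G).sum)).sum := by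
    intro l F G
    induction l with
    | nil => rfl
    | cons p l ih => simp [ih]
  unfold total
  rw [wordPairs, hsum]
  congr 1
  refine map_congr_left fun p _ => ?_
  rw [map_append, sum_append, map_map, map_map]
  congr 1
  · have : (insertions e p.1).map ((fun p : List (ℕ × Bool) × List (ℕ × Bool) =>
        if p.1.length = a then pairWeight f g h N p else 0) ∘ fun w => (w, p.2)) =
        (insertions e p.1).map (fun w => if p.1.length + 1 = a then
          pairWeight f g h N (w, p.2) else 0) := by
      refine map_congr_left fun w hw => ?_
      simp [length_of_mem_insertions hw]
    rw [this]
    split_ifs <;> simp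
  · simp only [Function.comp_def]
    split_ifs <;> simp

/-- Removing a label that is a non-leader in every pair and has constant weight. -/
theorem total_cons_of_nonleader {f : ℕ → ℕ → R} {g h : ℕ → R} {N e : ℕ} {L : List ℕ}
    (hN : 0 < N) (hfe : ∀ c, f e c = if c = 0 then 0 else 1) (hge : g e = 0) (hhe : h e = 0)
    (hf0 : ∀ x ∈ L, f x 0 = 0) {ℓ c : ℕ} (hc : L.length = ℓ + c) :
    total f g h N (e :: L) (ℓ + 1) =
      ℓ * total f g h N L ℓ + c * total f g h N L (ℓ + 1) := by
  rw [total_cons]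
  unfold total
  rw [← List.sum_map_mul_left, ← List.sum_map_mul_left, ← List.sum_map_add]
  congr 1
  refine map_congr_left fun p hp => ?_
  have hlen := length_add_length_of_mem_wordPairs hp
  have hm : ∀ x, x ∈ (p.1 ++ p.2).map Prod.fst → x ∈ L := fun x hx =>
    (mem_wordPairs_iff.1 hp).mem_iff.1 hx
  simp only [map_append, mem_append] at hm
  -- The front of the first word is no admissible position, since no leader precedes it; the front
  -- of the second word is one, under `N`. Hence the `+ 1` only in `h2`.
  have h1 : ((insertions e p.1).map (fun w => pairWeight f g h N (w, p.2))).sum =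
      p.1.length * pairWeight f g h N p := by
    simp only [pairWeight]
    rw [insertions, map_append, sum_append, sum_insert_leader_eq_zero f g hge, zero_add]
    exact sum_insert_nonleader_of_start f g p.1 (fun c' _ hc' => by simp [hfe, hc'.ne'])
      (by simp [hfe]) (fun x hx => hf0 x (hm x (Or.inl hx))) _ _
  have h2 : ((insertions e p.2).map (fun w => pairWeight f g h N (p.1, w))).sum =
      (p.2.length + 1) * pairWeight f g h N p := by
    unfold pairWeight
    rw [scan_list_sum f g p.1 (insertions e p.2) (fun w a => scan f h N a w (fun _ => 1)),
      ← scan_mul_cont]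
    refine scan_congr_cont f g fun b _ => ?_
    rw [insertions, map_append, sum_append, sum_insert_leader_eq_zero f h hhe, zero_add]
    exact sum_insert_nonleader f h p.2 (fun c' _ hc' => by simp [hfe, hc'.ne']) hN _ _
  rw [h1, h2]
  by_cases ha : p.1.length = ℓ
  · have : p.1.length ≠ ℓ + 1 := by omega
    simp [ha]
  · by_cases hb : p.1.length = ℓ + 1
    · have hc' : c = p.2.length + 1 := by omega
      simp [hb, hc']
    · simp [ha, hb]

/-- Removing the largest label, if a non-leader has to exceed its leader. -/
theorem sum_insertions_of_max {f : ℕ → ℕ → R} {g h : ℕ → R} {N e : ℕ} {L : List ℕ}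
    (hN : e < N) (he : ∀ x ∈ L, x < e) (h0 : 0 < e)
    (hf : ∀ x ∈ e :: L, ∀ c, f x c = if 0 < c ∧ c < x then 1 else 0)
    {p : List (ℕ × Bool) × List (ℕ × Bool)} (hp : p ∈ wordPairs L) :
    ((insertions e p.1).map (fun w => pairWeight f g h N (w, p.2))).sum =
      (p.1.length + if p.2 = [] then g e else 0) * pairWeight f g h N p ∧
    ((insertions e p.2).map (fun w => pairWeight f g h N (p.1, w))).sum =
      (p.2.length + h e) * pairWeight f g h N p := by
  have hm : ∀ x, x ∈ (p.1 ++ p.2).map Prod.fst → x ∈ L := fun x hx =>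
    (mem_wordPairs_iff.1 hp).mem_iff.1 hx
  simp only [map_append, mem_append] at hm
  have hm1 := fun x hx => hm x (Or.inl hx)
  have hm2 := fun x hx => hm x (Or.inr hx)
  have hfz : ∀ x ∈ L, ∀ c, c = 0 ∨ e ≤ c → f x c = 0 := by
    intro x hx c hc
    have := he x hx
    rw [hf x (by simp [hx]), if_neg (by omega)]
  have hfe : ∀ c', c' ∈ L → 0 < c' → f e c' = 1 := fun c' hc' h => by
    rw [hf e (by simp), if_pos ⟨h, he c' hc'⟩]
  have hfe0 : ∀ c, c = 0 ∨ e ≤ c → f e c = 0 := by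
    intro c hc
    rw [hf e (by simp), if_neg (by omega)]
  constructor
  · simp only [pairWeight]
    rw [insertions, map_append, sum_append,
      sum_insert_leader f g p.1 (fun x hx => hfz x (hm1 x hx) e (Or.inr le_rfl))
        (fun x hx => he x (hm1 x hx)) h0,
      sum_insert_nonleader_of_start f g p.1 (fun c' hc' => hfe c' (hm1 c' hc'))
        (hfe0 0 (Or.inl rfl)) (fun x hx => hfz x (hm1 x hx) 0 (Or.inl rfl)), scan_mul_cont]
    -- After `e` as last leader of the first word, a nonempty second word weighs `0`: a non-leader
    -- at its front lies below `N`, and a leader at its front cannot exceed `e`.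
    by_cases hp2 : p.2 = []
    · rw [if_pos hp2, hp2]
      simp only [scan]
      ring
    · rw [if_neg hp2, scan_eq_zero_of_lt f h hp2
        (fun x hx => hfz x (hm2 x hx) N (Or.inr hN.le)) (fun x hx => (he x (hm2 x hx)).le)]
      have := scan_mul_cont f g p.1 (0 : R) (fun _ => 0) 0 0
      simp only [zero_mul] at this
      rw [this]
      ring
  · unfold pairWeight
    rw [scan_list_sum f g p.1 (insertions e p.2) (fun w a => scan f h N a w (fun _ => 1)),
      ← scan_mul_cont]
    refine scan_congr_cont f g fun b hb => ?_
    have hbe : b < e := by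
      rcases hb with rfl | hb
      · exact h0
      · exact he b (hm1 b hb)
    rw [insertions, map_append, sum_append,
      sum_insert_leader f h p.2 (fun x hx => hfz x (hm2 x hx) e (Or.inr le_rfl))
        (fun x hx => he x (hm2 x hx)) hbe,
      sum_insert_nonleader_of_start f h p.2 (fun c' hc' => hfe c' (hm2 c' hc'))
        (hfe0 N (Or.inr hN.le)) (fun x hx => hfz x (hm2 x hx) N (Or.inr hN.le)), scan_mul_cont]
    ring

theorem total_cons_of_max {f : ℕ → ℕ → R} {g h : ℕ → R} {N e : ℕ} {L : List ℕ}
    (hN : e < N) (he : ∀ x ∈ L, x < e) (h0 : 0 < e)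
    (hf : ∀ x ∈ e :: L, ∀ c, f x c = if 0 < c ∧ c < x then 1 else 0)
    {ℓ c : ℕ} (hc : L.length = ℓ + 1 + c) :
    total f g h N (e :: L) (ℓ + 1) =
      ℓ * total f g h N L ℓ + (c + h e) * total f g h N L (ℓ + 1) := by
  rw [total_cons]
  unfold total
  rw [← List.sum_map_mul_left, ← List.sum_map_mul_left, ← List.sum_map_add]
  congr 1
  refine map_congr_left fun p hp => ?_
  have hlen := length_add_length_of_mem_wordPairs hp
  obtain ⟨h1, h2⟩ := sum_insertions_of_max (g := g) (h := h) hN he h0 hf hp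
  rw [h1, h2]
  by_cases ha : p.1.length = ℓ
  -- Here the second word has `c + 1` letters, so `e` cannot be a leader of the first.
  · have h3 : p.2 ≠ [] := by
      rintro h
      simp [h] at hlen
      omega
    simp [ha, h3]
  · by_cases hb : p.1.length = ℓ + 1
    · have hc' : c = p.2.length := by omega
      simp [hb, hc']
    · simp [ha, hb]

theorem total_cons_of_max_of_length {f : ℕ → ℕ → R} {g h : ℕ → R} {N e : ℕ} {L : List ℕ}
    (hN : e < N) (he : ∀ x ∈ L, x < e) (h0 : 0 < e)
    (hf : ∀ x ∈ e :: L, ∀ c, f x c = if 0 < c ∧ c < x then 1 else 0) :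
    total f g h N (e :: L) (L.length + 1) =
      (L.length + g e) * total f g h N L L.length := by
  rw [total_cons]
  unfold total
  rw [← List.sum_map_mul_left]
  congr 1
  refine map_congr_left fun p hp => ?_
  have hlen := length_add_length_of_mem_wordPairs hp
  obtain ⟨h1, h2⟩ := sum_insertions_of_max (g := g) (h := h) hN he h0 hf hp
  rw [h1, h2]
  by_cases ha : p.1.length = L.length
  · have h3 : p.2 = [] := by
      rw [← List.length_eq_zero_iff]
      omega
    simp [ha, h3]
  · have hb : p.1.length ≠ L.length + 1 := by omega
    simp [ha, hb]

/-! ### Rising factorials and evaluation of the total weight -/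

/-- The rising factorial `z (z + 1) ⋯ (z + n - 1)`. -/
def rising (z : R) (n : ℕ) : R := ∏ j ∈ Finset.range n, (z + j)

theorem rising_succ (z : R) (n : ℕ) : rising z (n + 1) = rising z n * (z + n) :=
  Finset.prod_range_succ _ _

theorem rising_succ' (z : R) (n : ℕ) : rising (z - 1) (n + 1) = (z - 1) * rising z n := by
  unfold rising
  rw [Finset.prod_range_succ', mul_comm]
  congr 1
  · simp
  · refine Finset.prod_congr rfl fun j _ => ?_
    push_cast; ring

theorem rising_sub_rising (z : R) (n : ℕ) :
    rising z n - rising (z - 1) n = n * rising z (n - 1) := by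
  cases n with
  | zero => simp [rising]
  | succ n => rw [rising_succ, rising_succ', Nat.add_sub_cancel]; push_cast; ring

/-- The total weight if every non-leader has to exceed its leader. -/
theorem total_of_increasing {f : ℕ → ℕ → R} {g h : ℕ → R} {N : ℕ} {x y : R} {L : List ℕ}
    (hL : L.Pairwise (· > ·)) (hN : ∀ e ∈ L, 0 < e ∧ e < N)
    (hf : ∀ e ∈ L, ∀ c, f e c = if 0 < c ∧ c < e then 1 else 0)
    (hg : ∀ e ∈ L, g e = y) (hh : ∀ e ∈ L, h e = x) {ℓ c : ℕ} (hc : L.length = ℓ + 1 + c) :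
    total f g h N L (ℓ + 1) = y * (rising x c * rising (y + c + 1) ℓ) := by
  induction L generalizing ℓ c with
  | nil => simp at hc; omega
  | cons e L ih =>
    rw [pairwise_cons] at hL
    have ih' := fun {ℓ c : ℕ} => ih (ℓ := ℓ) (c := c) hL.2 (fun z hz => hN z (by simp [hz]))
      (fun z hz => hf z (by simp [hz])) (fun z hz => hg z (by simp [hz]))
      (fun z hz => hh z (by simp [hz]))
    obtain ⟨h0, heN⟩ := hN e (by simp)
    have hge := hg e (by simp)
    have hhe := hh e (by simp)
    simp only [length_cons] at hc
    cases c with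
    | zero =>
      obtain rfl : ℓ = L.length := by omega
      rw [total_cons_of_max_of_length heN hL.1 h0 hf, hge]
      rcases hl : L.length with _ | n
      · rw [List.length_eq_zero_iff] at hl
        subst hl
        simp [total, wordPairs, pairWeight, scan, rising]
      · rw [ih' (c := 0) (by omega)]
        simp only [rising_succ]
        push_cast; ring
    | succ c =>
      rw [total_cons_of_max heN hL.1 h0 hf (c := c) (by omega), hhe, ih' (c := c) (by omega)]
      cases ℓ with
      | zero => simp only [rising_succ]; simp [rising]; ring
      | succ ℓ =>
        -- The two terms combine by `(ℓ + 1) z^(ℓ) + (z - 1)^(ℓ + 1) = z^(ℓ + 1)` at `z = y + c +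
        -- 2`.
        rw [ih' (c := c + 1) (by omega)]
        have h1 := rising_succ (y + c + 1 + 1) ℓ
        have h2 := rising_succ' (y + c + 1 + 1) ℓ
        rw [add_sub_cancel_right] at h2
        rw [rising_succ x]
        push_cast
        rw [show y + ((c : R) + 1) + 1 = y + c + 1 + 1 by ring, h1, h2]
        ring

/-- Pascal's rule: the sum is `(1 - uE)^(r + 1)` applied to `F` at `0`, with `E` the shift, and one
factor is split off. -/
theorem sum_range_neg_pow_choose_succ (u : R) (F : ℕ → R) (r : ℕ) :
    ∑ i ∈ Finset.range (r + 2), (-u) ^ i * ((r + 1).choose i : R) * F i =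
      ∑ i ∈ Finset.range (r + 1), (-u) ^ i * (r.choose i : R) * (F i - u * F (i + 1)) := by
  rw [Finset.sum_range_succ']
  simp only [Nat.choose_succ_succ, Nat.cast_add, mul_add, add_mul, mul_sub, Finset.sum_add_distrib,
    Finset.sum_sub_distrib]
  have h1 : ∑ i ∈ Finset.range (r + 1), (-u) ^ (i + 1) * (r.choose (i + 1) : R) * F (i + 1) +
      (-u) ^ 0 * ((r + 1).choose 0 : R) * F 0 =
      ∑ i ∈ Finset.range (r + 1), (-u) ^ i * (r.choose i : R) * F i := by
    have := Finset.sum_range_succ' (fun i => (-u) ^ i * (r.choose i : R) * F i) (r + 1)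
    rw [Finset.sum_range_succ] at this
    simp at this ⊢
    rw [← this]
  have h2 : ∑ i ∈ Finset.range (r + 1), (-u) ^ (i + 1) * (r.choose i : R) * F (i + 1) =
      - ∑ i ∈ Finset.range (r + 1), (-u) ^ i * (r.choose i : R) * (u * F (i + 1)) := by
    rw [← Finset.sum_neg_distrib]
    refine Finset.sum_congr rfl fun i _ => ?_
    ring
  rw [← h1, h2]
  ring

/-- The alternating sum that evaluates the total weight. -/
def altSum (u x y : R) (r c ℓ : ℕ) : R :=
  ∑ i ∈ Finset.range (r + 1), (-u) ^ i * (r.choose i : R) *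
    (rising (x - i) c * rising (y + c + 1 - i) ℓ)

/-- With `A = (x - i)^(c)`, `B = (y + c + 1 - i)^(ℓ)` and `A'`, `B'` their values at `i + 1`, one
has `AB - uA'B' = (1 - u)AB + u(A(B - B') + (A - A')B')`, and both differences are given by
`rising_sub_rising`. -/
theorem altSum_succ (u x y : R) (r c ℓ : ℕ) :
    altSum u x y (r + 1) c ℓ = (1 - u) * altSum u x y r c ℓ +
      u * (ℓ * altSum u x y r c (ℓ - 1) + c * altSum u x y r (c - 1) ℓ) := by
  unfold altSum
  rw [sum_range_neg_pow_choose_succ]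
  simp only [Finset.mul_sum, ← Finset.sum_add_distrib]
  refine Finset.sum_congr rfl fun i _ => ?_
  have h1 := rising_sub_rising (x - i) c
  have h2 := rising_sub_rising (y + c + 1 - i) ℓ
  have e1 : x - ((i + 1 : ℕ) : R) = x - i - 1 := by push_cast; ring
  have e2 : y + c + 1 - ((i + 1 : ℕ) : R) = y + c + 1 - i - 1 := by push_cast; ring
  rw [e1, e2]
  cases c with
  | zero =>
    simp only [rising, Finset.range_zero, Finset.prod_empty, Nat.cast_zero] at h2 ⊢
    linear_combination ((-u) ^ i * (r.choose i : R)) * u * h2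
  | succ c =>
    rw [Nat.add_sub_cancel] at h1 ⊢
    have e3 : y + ((c + 1 : ℕ) : R) + 1 - i - 1 = y + c + 1 - i := by push_cast; ring
    rw [e3] at h2 ⊢
    linear_combination ((-u) ^ i * (r.choose i : R)) * u *
      (rising (x - i) (c + 1) * h2 + rising (y + c + 1 - i) ℓ * h1)

/-- The total weight if the labels in `Lf` have their true weights, and those in `L` are leaders or
exceed their leaders. -/
theorem total_append {f : ℕ → ℕ → R} {g h : ℕ → R} {N : ℕ} {u x y : R} {Lf L : List ℕ}
    (hL : (Lf ++ L).Pairwise (· > ·)) (hN : ∀ e ∈ Lf ++ L, 0 < e ∧ e < N)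
    (hf : ∀ e ∈ L, ∀ c, f e c = if 0 < c ∧ c < e then 1 else 0)
    (hg : ∀ e ∈ L, g e = y) (hh : ∀ e ∈ L, h e = x)
    (hf' : ∀ e ∈ Lf, ∀ c, f e c = if c = 0 then 0 else if c < e then 1 else u)
    (hg' : ∀ e ∈ Lf, g e = (1 - u) * y) (hh' : ∀ e ∈ Lf, h e = (1 - u) * x)
    {ℓ c : ℕ} (hc : Lf.length + L.length = ℓ + 1 + c) :
    total f g h N (Lf ++ L) (ℓ + 1) = y * altSum u x y Lf.length c ℓ := by
  induction Lf using List.reverseRecOn generalizing L f g h ℓ c with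
  | nil =>
    rw [nil_append] at hL hN ⊢
    rw [total_of_increasing (x := x) (y := y) (c := c) hL hN hf hg hh (by simpa using hc)]
    simp [altSum]
  | append_singleton Lf e ih =>
    have hnd : (Lf ++ [e] ++ L).Nodup := hL.imp (fun h => Nat.ne_of_gt h)
    have heq : Lf ++ [e] ++ L = Lf ++ e :: L := by simp
    rw [heq] at hL hN hnd ⊢
    have hperm : (Lf ++ e :: L).Perm (e :: (Lf ++ L)) := perm_middle
    have hnd' := hperm.nodup_iff.1 hnd
    rw [nodup_cons] at hnd'
    have hne : ∀ z ∈ Lf ++ L, z ≠ e := fun z hz h => hnd'.1 (h ▸ hz)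
    have hneL : ∀ z ∈ L, z ≠ e := fun z hz => hne z (by simp [hz])
    have hneLf : ∀ z ∈ Lf, z ≠ e := fun z hz => hne z (by simp [hz])
    have hN0 := hN e (by simp)
    simp only [length_append, length_cons, length_nil] at hc ⊢
    -- In the first summand `e` joins `L` as its new largest label; in the second it is a non-leader
    -- of constant weight and gets removed.
    rw [total_linear (α := 1 - u) (β := u) (e := e)
      (f₁ := Function.update f e (fun c => if 0 < c ∧ c < e then 1 else 0))
      (g₁ := Function.update g e y) (h₁ := Function.update h e x)
      (f₂ := Function.update f e (fun c => if c = 0 then 0 else 1))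
      (g₂ := Function.update g e 0) (h₂ := Function.update h e 0) hnd (by simp)
      (by
        intro c
        rw [hf' e (by simp)]
        simp only [Function.update_self]
        rcases Nat.eq_zero_or_pos c with rfl | hc
        · simp
        · by_cases hce : c < e <;> simp [hc, hc.ne', hce])
      (by rw [hg' e (by simp)]; simp) (by rw [hh' e (by simp)]; simp)
      (fun z hz => by simp [hz]) (fun z hz => by simp [hz]) (fun z hz => by simp [hz])
      (fun z hz => by simp [hz]) (fun z hz => by simp [hz]) (fun z hz => by simp [hz])]
    have hsub : (Lf ++ L).Sublist (Lf ++ e :: L) := by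
      exact (List.sublist_cons_self e L).append_left Lf
    have hmemL : ∀ z ∈ e :: L, z = e ∨ (z ∈ L ∧ z ≠ e) := by
      intro z hz
      rcases mem_cons.1 hz with h | h
      · exact Or.inl h
      · exact Or.inr ⟨h, hneL z h⟩
    rw [ih (L := e :: L) (c := c) (ℓ := ℓ) hL hN
      (fun z hz c => by
        rcases hmemL z hz with rfl | ⟨h1, h2⟩
        · simp
        · rw [Function.update_of_ne h2, hf z h1])
      (fun z hz => by
        rcases hmemL z hz with rfl | ⟨h1, h2⟩
        · simp
        · rw [Function.update_of_ne h2, hg z h1])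
      (fun z hz => by
        rcases hmemL z hz with rfl | ⟨h1, h2⟩
        · simp
        · rw [Function.update_of_ne h2, hh z h1])
      (fun z hz c => by rw [Function.update_of_ne (hneLf z hz), hf' z (by simp [hz])])
      (fun z hz => by rw [Function.update_of_ne (hneLf z hz), hg' z (by simp [hz])])
      (fun z hz => by rw [Function.update_of_ne (hneLf z hz), hh' z (by simp [hz])])
      (by simp only [length_cons]; omega)]
    have ih2 := fun {ℓ c : ℕ} => ih (L := L) (ℓ := ℓ) (c := c)
      (f := Function.update f e (fun c => if c = 0 then 0 else 1))
      (g := Function.update g e 0) (h := Function.update h e 0)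
      (hL.sublist hsub) (fun z hz => hN z (hsub.subset hz))
      (fun z hz c => by rw [Function.update_of_ne (hneL z hz), hf z hz])
      (fun z hz => by rw [Function.update_of_ne (hneL z hz), hg z hz])
      (fun z hz => by rw [Function.update_of_ne (hneL z hz), hh z hz])
      (fun z hz c => by rw [Function.update_of_ne (hneLf z hz), hf' z (by simp [hz])])
      (fun z hz => by rw [Function.update_of_ne (hneLf z hz), hg' z (by simp [hz])])
      (fun z hz => by rw [Function.update_of_ne (hneLf z hz), hh' z (by simp [hz])])
    rw [total_perm _ _ _ _ hnd hperm, total_cons_of_nonleader (c := c) (by omega) (by simp)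
      (by simp) (by simp)
      (fun z hz => by
        rw [Function.update_of_ne (hne z hz)]
        rcases mem_append.1 hz with h | h
        · rw [hf' z (by simp [h])]; simp
        · rw [hf z h]; simp)
      (by simp only [length_append]; omega), altSum_succ]
    -- The truncated `ℓ - 1` and `c - 1` are harmless: those terms carry the factors `ℓ` and `c`.
    rcases ℓ with _ | ℓ <;> rcases c with _ | c
    · simp; ring
    · rw [ih2 (c := c) (by omega)]; simp; ring
    · rw [ih2 (c := 0) (by omega)]; simp; ring
    · rw [ih2 (c := c + 1) (by omega), ih2 (c := c) (by omega)]; simp; ring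

/-! ### Flagged words as sequences of blocks -/

open OrderedChainForest

/-- The flagged word of a sequence of nonempty blocks: the first element of each block is marked as
its leader. -/
def toWord : List (List ℕ) → List (ℕ × Bool)
  | [] => []
  | [] :: Bs => toWord Bs
  | (b :: t) :: Bs => (b, true) :: (t.map (fun x => (x, false)) ++ toWord Bs)

theorem map_fst_toWord (Bs : List (List ℕ)) : (toWord Bs).map Prod.fst = Bs.flatten := by
  induction Bs with
  | nil => rfl
  | cons B Bs ih => cases B <;> simp [toWord, ih, Function.comp_def]

theorem exists_eq_append_toWord (w : List (ℕ × Bool)) : ∃ (l : List ℕ) (Bs : List (List ℕ)),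
    (∀ B ∈ Bs, B ≠ []) ∧ w = l.map (fun x => (x, false)) ++ toWord Bs := by
  induction w with
  | nil => exact ⟨[], [], by simp, rfl⟩
  | cons t w ih =>
    obtain ⟨x, b⟩ := t
    obtain ⟨l, Bs, h, rfl⟩ := ih
    cases b
    · exact ⟨x :: l, Bs, h, rfl⟩
    · exact ⟨[], (x :: l) :: Bs, by simpa using h, rfl⟩

theorem map_append_inj {l l' : List ℕ} {w w' : List (ℕ × Bool)} (hw : ∀ x v, w ≠ (x, false) :: v)
    (hw' : ∀ x v, w' ≠ (x, false) :: v)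
    (h : l.map (fun x => (x, false)) ++ w = l'.map (fun x => (x, false)) ++ w') :
    l = l' ∧ w = w' := by
  induction l generalizing l' with
  | nil =>
    cases l' with
    | nil => exact ⟨rfl, h⟩
    | cons x l' => exact absurd h (hw _ _)
  | cons y l ih =>
    cases l' with
    | nil => exact absurd h.symm (hw' _ _)
    | cons x l' =>
      simp only [map_cons, cons_append, cons.injEq, Prod.mk.injEq, and_true] at h
      obtain ⟨rfl, h⟩ := h
      obtain ⟨rfl, h'⟩ := ih h
      exact ⟨rfl, h'⟩

theorem toWord_ne_cons {Bs : List (List ℕ)} (x : ℕ) (v : List (ℕ × Bool)) :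
    toWord Bs ≠ (x, false) :: v := by
  induction Bs with
  | nil => simp [toWord]
  | cons B Bs ih => cases B <;> simp [toWord, ih]

theorem toWord_inj {Bs Bs' : List (List ℕ)} (hB : ∀ B ∈ Bs, B ≠ []) (hB' : ∀ B ∈ Bs', B ≠ [])
    (h : toWord Bs = toWord Bs') : Bs = Bs' := by
  induction Bs generalizing Bs' with
  | nil =>
    rcases Bs' with _ | ⟨_ | ⟨b, t⟩, Bs'⟩
    · rfl
    · simp at hB'
    · simp [toWord] at h
  | cons B Bs ih =>
    rcases B with _ | ⟨b, t⟩
    · simp at hB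
    · rcases Bs' with _ | ⟨_ | ⟨b', t'⟩, Bs'⟩
      · simp [toWord] at h
      · simp at hB'
      · simp only [toWord, cons.injEq, Prod.mk.injEq, and_true] at h
        obtain ⟨rfl, h⟩ := h
        obtain ⟨rfl, h'⟩ := map_append_inj toWord_ne_cons toWord_ne_cons h
        rw [ih (fun B hb => hB B (by simp [hb])) (fun B hb => hB' B (by simp [hb])) h']

theorem wt_cons (b : ℕ) (t : List ℕ) : wt (b :: t) = t.countP (fun x => decide (x < b)) := by
  simp [wt, leader]

/-- The list `l` holds the leaders still to come, so that the first word of a pair can be evaluated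
with the second behind it. -/
theorem scan_toWord {f : ℕ → ℕ → R} {g : ℕ → R} {u γ : R} {Bs : List (List ℕ)}
    (hB : ∀ B ∈ Bs, B ≠ []) (hnd : Bs.flatten.Nodup)
    (hf : ∀ x ∈ Bs.flatten, ∀ c, f x c = if c = 0 then 0 else if c < x then 1 else u)
    (hg : ∀ x ∈ Bs.flatten, g x = γ) (l : List ℕ) (K : R) (c a : ℕ) :
    scan f g c a (toWord Bs) (fun b => if (b :: l).IsChain (· < ·) then K else 0) =
      if (a :: (Bs.map leader ++ l)).IsChain (· < ·) then
        γ ^ Bs.length * u ^ (Bs.map wt).sum * K else 0 := by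
  induction Bs generalizing c a with
  | nil => simp [toWord, scan]
  | cons B Bs ih =>
    rcases B with _ | ⟨b, t⟩
    · simp at hB
    simp only [flatten_cons, cons_append, nodup_cons] at hnd
    have ih' := ih (fun B h => hB B (by simp [h])) (nodup_append.1 hnd.2).2.1
      (fun x hx => hf x (by simp at hx ⊢; tauto)) (fun x hx => hg x (by simp at hx ⊢; tauto)) b b
    simp only [toWord, scan, scan_append, ih', map_cons, cons_append,
      isChain_cons_cons, sum_cons, length_cons]
    have hl : leader (b :: t) = b := rfl
    rw [hl]
    by_cases hab : a < b
    · have hprod : (t.map (fun x => f x b)).prod = u ^ wt (b :: t) := by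
        rw [wt_cons]
        have hft : ∀ x ∈ t, f x b = if x < b then u else 1 := by
          intro x hx
          have hxb : x ≠ b := fun h => hnd.1 (by simp [← h, hx])
          rw [hf x (by simp [hx]), if_neg (by omega)]
          by_cases h : x < b
          · rw [if_neg (by omega), if_pos h]
          · rw [if_pos (by omega), if_neg h]
        rw [map_congr_left hft]
        clear * -
        induction t with
        | nil => simp
        | cons z t ih => by_cases h : z < b <;> simp [h, ih, pow_succ, mul_comm]
      rw [hprod, hg b (by simp)]
      simp only [hab, true_and, if_true, pow_succ, pow_add]
      split_ifs <;> ring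
    · simp [hab]

/-- Pairs of sequences of blocks, with the non-leaders of the block that has the infinite leader,
that together use the labels in `L`; the blocks of the first sequence have `n` elements. -/
def blockTriples (L : List ℕ) (n : ℕ) : Set (List (List ℕ) × List (List ℕ) × List ℕ) :=
  {t | (∀ B ∈ t.1, B ≠ []) ∧ (∀ B ∈ t.2.1, B ≠ []) ∧
    (t.1.flatten ++ (t.2.2 ++ t.2.1.flatten)).Perm L ∧ t.1.flatten.length = n}

/-- The pair of flagged words of a triple. -/
def toWordPair (t : List (List ℕ) × List (List ℕ) × List ℕ) :
    List (ℕ × Bool) × List (ℕ × Bool) :=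
  (toWord t.1, t.2.2.map (fun x => (x, false)) ++ toWord t.2.1)

theorem map_fst_toWordPair (t : List (List ℕ) × List (List ℕ) × List ℕ) :
    ((toWordPair t).1 ++ (toWordPair t).2).map Prod.fst =
      t.1.flatten ++ (t.2.2 ++ t.2.1.flatten) := by
  simp [toWordPair, map_fst_toWord, Function.comp_def]

theorem length_toWordPair (t : List (List ℕ) × List (List ℕ) × List ℕ) :
    (toWordPair t).1.length = t.1.flatten.length := by
  rw [← map_fst_toWord, length_map, toWordPair]

theorem injOn_toWordPair (L : List ℕ) (n : ℕ) : Set.InjOn toWordPair (blockTriples L n) := by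
  rintro ⟨A, B, c⟩ ⟨h1, h2, -⟩ ⟨A', B', c'⟩ ⟨h1', h2', -⟩ h
  simp only [toWordPair, Prod.mk.injEq] at h h1 h2 h1' h2'
  obtain rfl := toWord_inj h1 h1' h.1
  obtain ⟨rfl, h3⟩ := map_append_inj toWord_ne_cons toWord_ne_cons h.2
  obtain rfl := toWord_inj h2 h2' h3
  rfl

theorem finite_blockTriples (L : List ℕ) (n : ℕ) : (blockTriples L n).Finite := by
  refine Set.Finite.of_finite_image (Set.Finite.subset (wordPairs L).finite_toSet ?_)
    (injOn_toWordPair L n)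
  rintro _ ⟨t, ht, rfl⟩
  exact mem_wordPairs_iff.2 (by rw [map_fst_toWordPair]; exact ht.2.2.1)

/-- The exponent of a triple: weights of the blocks plus non-leaders of the last block. -/
def tripleWt (t : List (List ℕ) × List (List ℕ) × List ℕ) : ℕ :=
  (t.1.map wt).sum + ((t.2.1.map wt).sum + t.2.2.length)

-- Pairs whose first word starts with a non-leader weigh `0`; the other pairs correspond bijectively
-- to triples.
open Classical in
theorem total_eq_sum_blockTriples {f : ℕ → ℕ → R} {g h : ℕ → R} {N : ℕ} {u γ η : R} {L : List ℕ}
    (hL : L.Nodup) (hN : ∀ e ∈ L, e < N)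
    (hf : ∀ e ∈ L, ∀ c, f e c = if c = 0 then 0 else if c < e then 1 else u)
    (hg : ∀ e ∈ L, g e = γ) (hh : ∀ e ∈ L, h e = η) (n : ℕ) :
    total f g h N L n = ∑ t ∈ (finite_blockTriples L n).toFinset,
      if (0 :: (t.1 ++ t.2.1).map leader).IsChain (· < ·) then
        γ ^ t.1.length * η ^ t.2.1.length * u ^ tripleWt t else 0 := by
  have hval : ∀ t ∈ blockTriples L n, pairWeight f g h N (toWordPair t) =
      if (0 :: (t.1 ++ t.2.1).map leader).IsChain (· < ·) then
        γ ^ t.1.length * η ^ t.2.1.length * u ^ tripleWt t else 0 := by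
    rintro ⟨A, B, c⟩ ⟨hA, hB, hp, -⟩
    simp only at hA hB hp
    have hmem : ∀ x, x ∈ A.flatten ∨ x ∈ c ∨ x ∈ B.flatten → x ∈ L := fun x hx =>
      hp.mem_iff.1 (by simpa only [mem_append] using hx)
    have hnd := hp.nodup_iff.2 hL
    obtain ⟨n1, n2, -⟩ := nodup_append.1 hnd
    obtain ⟨-, n3, -⟩ := nodup_append.1 n2
    have h2 : ∀ a, scan f h N a (toWord B) (fun _ => 1) =
        if (a :: B.map leader).IsChain (· < ·) then η ^ B.length * u ^ (B.map wt).sum else 0 := by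
      intro a
      have := scan_toWord (u := u) (γ := η) hB n3 (fun x hx => hf x (hmem x (by tauto)))
        (fun x hx => hh x (hmem x (by tauto))) [] (1 : R) N a
      simpa using this
    -- All labels lie below `N`, so every non-leader of the last block contributes `u`.
    have hc : (c.map (fun x => f x N)).prod = u ^ c.length := by
      have : c.map (fun x => f x N) = c.map (fun _ => u) := by
        refine map_congr_left fun x hx => ?_
        have hxL := hmem x (by tauto)
        have := hN x hxL
        rw [hf x hxL, if_neg (by omega), if_neg (by omega)]
      rw [this]
      simp
    simp only [pairWeight, toWordPair, scan_append, hc, h2, mul_ite, mul_zero]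
    rw [scan_toWord (u := u) (γ := γ) hA n1 (fun x hx => hf x (hmem x (by tauto)))
        (fun x hx => hg x (hmem x (by tauto)))]
    simp only [map_append, tripleWt, pow_add]
    split_ifs <;> ring
  have hmemf : ∀ t, t ∈ (finite_blockTriples L n).toFinset ↔ t ∈ blockTriples L n := by simp
  rw [← Finset.sum_congr rfl (fun t ht => hval t ((hmemf t).1 ht)),
    ← Finset.sum_image (f := fun p => pairWeight f g h N p)
      (fun t ht t' ht' => injOn_toWordPair L n ((hmemf t).1 ht) ((hmemf t').1 ht')), total,
    ← List.sum_toFinset _ (nodup_wordPairs hL), ← Finset.sum_filter]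
  symm
  refine Finset.sum_subset ?_ ?_
  · intro p hp
    obtain ⟨t, ht, rfl⟩ := Finset.mem_image.1 hp
    obtain ⟨-, -, h3, h4⟩ := (hmemf t).1 ht
    rw [Finset.mem_filter, List.mem_toFinset, mem_wordPairs_iff, map_fst_toWordPair,
      length_toWordPair]
    exact ⟨h3, h4⟩
  · rintro ⟨w₁, w₂⟩ hp hnot
    rw [Finset.mem_filter, List.mem_toFinset, mem_wordPairs_iff] at hp
    obtain ⟨l, A, hA, rfl⟩ := exists_eq_append_toWord w₁
    obtain ⟨c, B, hB, rfl⟩ := exists_eq_append_toWord w₂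
    cases l with
    | nil =>
      refine absurd (Finset.mem_image.2 ⟨(A, B, c), (hmemf _).2 ⟨hA, hB, ?_, ?_⟩, rfl⟩) hnot
      · rw [← map_fst_toWordPair]; exact hp.1
      · rw [← length_toWordPair]; exact hp.2
    | cons x l =>
      have hx : x ∈ L := hp.1.mem_iff.1 (by simp)
      simp [pairWeight, scan, hf x hx]

/-! ### Extraction of coefficients -/

open Polynomial in
theorem coeff_rising {S : Type*} [CommRing S] (a : ℤ) (n r : ℕ) :
    (rising (X + C (a : S)) n).coeff r = ((sumProducts ((n : ℤ) - r) a (a + n - 1) : ℤ) : S) := by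
  have hprod : rising (X + C (a : S)) n =
      ∏ j ∈ Finset.range n, (X + C (((a + j : ℤ)) : S)) := by
    refine Finset.prod_congr rfl fun j _ => ?_
    push_cast
    rw [map_add, add_assoc]
    simp
  by_cases hr : r ≤ n
  · rw [hprod, Finset.prod_X_add_C_coeff _ _ (by simpa using hr), sumProducts,
      if_neg (by omega), Finset.card_range, show ((n : ℤ) - r).toNat = n - r by omega]
    let φ : ℕ ↪ ℤ := ⟨fun j => a + j, fun i j h => by simpa using h⟩
    have hφ : ∀ j, φ j = a + j := fun _ => rfl
    have hI : Finset.Icc a (a + n - 1) = (Finset.range n).map φ := by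
      ext z
      simp only [Finset.mem_Icc, Finset.mem_map, Finset.mem_range, hφ]
      constructor
      · intro h
        exact ⟨(z - a).toNat, by omega, by omega⟩
      · rintro ⟨j, hj, rfl⟩
        omega
    rw [hI, Finset.powersetCard_map, Finset.sum_map]
    push_cast
    refine Finset.sum_congr rfl fun T _ => ?_
    simp [hφ, Finset.mapEmbedding_apply, Finset.prod_map]
  · have hdeg : (rising (X + C (a : S)) n).natDegree ≤ n := by
      rw [hprod]
      refine (natDegree_prod_le _ _).trans ?_
      calc ∑ j ∈ Finset.range n, (X + C (((a + j : ℤ)) : S)).natDegree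
          ≤ ∑ j ∈ Finset.range n, 1 := by
            refine Finset.sum_le_sum fun j _ => ?_
            exact (natDegree_add_le _ _).trans
              (max_le natDegree_X_le ((natDegree_C _).le.trans zero_le_one))
        _ = n := by simp
    rw [coeff_eq_zero_of_natDegree_lt (by omega), sumProducts, if_pos (by omega)]
    simp

theorem map_rising {S T : Type*} [CommRing S] [CommRing T] (φ : S →+* T) (z : S) (n : ℕ) :
    φ (rising z n) = rising (φ z) n := by
  simp [rising, map_prod]

-- The outer variable plays the role of `y`, the inner one that of `x`.
open Polynomial in
theorem coeff_coeff_altSum {S : Type*} [CommRing S] (u : S) (s c ℓ p m : ℕ) :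
    ((altSum (C (C u)) (C X) (X : S[X][X]) s c ℓ).coeff p).coeff m =
      ∑ i ∈ Finset.range (s + 1), (-u) ^ i * (s.choose i : S) *
        ((sumProducts ((c : ℤ) - m) (-(i : ℤ)) (-(i : ℤ) + c - 1) *
          sumProducts ((ℓ : ℤ) - p) ((c : ℤ) + 1 - i) ((c : ℤ) + 1 - i + ℓ - 1) : ℤ) : S) := by
  unfold altSum
  rw [finsetSum_coeff, finsetSum_coeff]
  refine Finset.sum_congr rfl fun i _ => ?_
  have h1 : rising (C X - (i : S[X][X])) c =
      C (rising (X + C (((-(i : ℤ) : ℤ)) : S)) c) := by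
    rw [map_rising]
    congr 1
    simp [sub_eq_add_neg]
  have h2 : rising ((X : S[X][X]) + c + 1 - i) ℓ =
      rising (X + C ((((c : ℤ) + 1 - i : ℤ)) : S[X])) ℓ := by
    congr 1
    simp
    ring
  have h3 : (-C (C u)) ^ i * (s.choose i : S[X][X]) = C (C ((-u) ^ i * (s.choose i : S))) := by
    simp
  rw [h1, h2, h3, ← mul_assoc, ← C_mul, coeff_C_mul, coeff_rising, mul_assoc, coeff_C_mul,
    ← C_eq_intCast, coeff_mul_C, coeff_rising]
  push_cast
  ring

open Classical in
open Polynomial in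
theorem one_sub_pow_mul_sum {N s ℓ c p m : ℕ} {L : List ℕ} (hL : L.Pairwise (· > ·))
    (hN : ∀ e ∈ L, 0 < e ∧ e < N) (hs : L.length = s) (hc : s = ℓ + 1 + c)
    {S : Type*} [CommRing S] (u : S) :
    (1 - u) ^ (p + 1 + m) * ∑ t ∈ (finite_blockTriples L (ℓ + 1)).toFinset with
        (0 :: (t.1 ++ t.2.1).map leader).IsChain (· < ·) ∧ t.1.length = p + 1 ∧ t.2.1.length = m,
        u ^ tripleWt t =
      ∑ i ∈ Finset.range (s + 1), (-u) ^ i * (s.choose i : S) *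
        ((sumProducts ((c : ℤ) - m) (-(i : ℤ)) (-(i : ℤ) + c - 1) *
          sumProducts ((ℓ : ℤ) - p) ((c : ℤ) + 1 - i) ((c : ℤ) + 1 - i + ℓ - 1) : ℤ) : S) := by
  let f : ℕ → ℕ → S[X][X] := fun x c => if c = 0 then 0 else if c < x then 1 else C (C u)
  let g : ℕ → S[X][X] := fun _ => (1 - C (C u)) * X
  let h : ℕ → S[X][X] := fun _ => (1 - C (C u)) * C X
  have h1 := total_append (f := f) (g := g) (h := h) (N := N) (Lf := L) (L := []) (u := C (C u))
    (x := C X) (y := X) (ℓ := ℓ) (c := c) (by simpa using hL) (by simpa using hN) (by simp)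
    (by simp) (by simp) (fun _ _ _ => rfl) (fun _ _ => rfl) (fun _ _ => rfl) (by simp; omega)
  rw [append_nil, total_eq_sum_blockTriples (hL.imp (fun h => Nat.ne_of_gt h))
    (fun e he => (hN e he).2) (fun _ _ _ => rfl) (fun _ _ => rfl) (fun _ _ => rfl), hs] at h1
  -- The factor `y` in front of `altSum` lowers the exponent `p + 1` to `p`.
  have h2 := congrArg (fun P => (P.coeff (p + 1)).coeff m) h1
  simp only [coeff_X_mul, coeff_coeff_altSum, finsetSum_coeff] at h2
  rw [← h2, Finset.mul_sum, Finset.sum_filter]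
  refine Finset.sum_congr rfl fun t _ => ?_
  have h3 : ∀ a b w : ℕ, ((1 - C (C u)) * (X : S[X][X])) ^ a * ((1 - C (C u)) * C X) ^ b *
      C (C u) ^ w = C (C ((1 - u) ^ (a + b) * u ^ w) * X ^ b) * X ^ a := by
    intro a b w
    simp only [map_mul, map_pow, map_sub, map_one, mul_pow]
    ring
  by_cases hch : (0 :: (t.1 ++ t.2.1).map leader).IsChain (· < ·)
  · rw [if_pos hch, h3, coeff_C_mul, coeff_X_pow]
    simp only [hch, true_and]
    by_cases ha : t.1.length = p + 1
    · by_cases hb : t.2.1.length = m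
      · simp only [ha, hb, and_self, if_true, mul_one]
        rw [coeff_C_mul, coeff_X_pow, if_pos rfl, mul_one]
      · have hb' : m ≠ t.2.1.length := fun h => hb h.symm
        simp only [ha, hb, and_false, if_false, if_true, mul_one]
        rw [coeff_C_mul, coeff_X_pow, if_neg hb', mul_zero]
    · have ha' : p + 1 ≠ t.1.length := fun h => ha h.symm
      simp [ha, ha']
  · rw [if_neg hch, if_neg (fun h => hch h.1)]
    simp

open Classical in
open PowerSeries in
theorem card_blockTriples {N s ℓ c p m : ℕ} {L : List ℕ} (hL : L.Pairwise (· > ·))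
    (hN : ∀ e ∈ L, 0 < e ∧ e < N) (hs : L.length = s) (hc : s = ℓ + 1 + c) (q : ℕ) :
    (({t ∈ (finite_blockTriples L (ℓ + 1)).toFinset |
        ((0 :: (t.1 ++ t.2.1).map leader).IsChain (· < ·) ∧ t.1.length = p + 1 ∧
          t.2.1.length = m) ∧ tripleWt t = q}.card : ℕ) : ℤ) =
      ∑ i ∈ Finset.range (q + 1), (-1) ^ i * (s.choose i : ℤ) *
        sumProducts ((c : ℤ) - m) (-(i : ℤ)) (-(i : ℤ) + c - 1) *
        sumProducts ((ℓ : ℤ) - p) ((c : ℤ) + 1 - i) ((c : ℤ) + 1 - i + ℓ - 1) *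
        ((p + m + (q - i)).choose (p + m) : ℤ) := by
  have h1 := one_sub_pow_mul_sum (p := p) (m := m) hL hN hs hc (X : ℤ⟦X⟧)
  rw [show p + 1 + m = p + m + 1 by ring] at h1
  -- This series is the inverse of `(1 - X)^(p + m + 1)`.
  have h2 := congrArg (fun P => (mk fun n => ((p + m + n).choose (p + m) : ℤ)) * P) h1
  rw [← mul_assoc, mk_add_choose_mul_one_sub_pow_eq_one, one_mul] at h2
  have h3 := congrArg (coeff q) h2
  rw [map_sum, Finset.mul_sum, map_sum] at h3
  simp only [coeff_X_pow] at h3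
  rw [Finset.sum_boole, Finset.filter_filter] at h3
  set P : ℕ → ℤ := fun i => sumProducts ((c : ℤ) - m) (-(i : ℤ)) (-(i : ℤ) + c - 1) *
        sumProducts ((ℓ : ℤ) - p) ((c : ℤ) + 1 - i) ((c : ℤ) + 1 - i + ℓ - 1) with hP
  have h4 : ∀ i, coeff q ((mk fun n => ((p + m + n).choose (p + m) : ℤ)) *
      ((-X) ^ i * ((s.choose i : ℕ) : ℤ⟦X⟧) * ((P i : ℤ) : ℤ⟦X⟧))) =
      if i ≤ q then (-1) ^ i * (s.choose i : ℤ) * P i * ((p + m + (q - i)).choose (p + m) : ℤ)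
        else 0 := by
    intro i
    have : (mk fun n => ((p + m + n).choose (p + m) : ℤ)) *
        ((-X) ^ i * ((s.choose i : ℕ) : ℤ⟦X⟧) * ((P i : ℤ) : ℤ⟦X⟧)) =
        C ((-1) ^ i * (s.choose i : ℤ) * P i) *
          ((mk fun n => ((p + m + n).choose (p + m) : ℤ)) * X ^ i) := by
      rw [neg_pow]
      simp only [map_mul, map_pow, map_neg, map_one, map_natCast]
      simp
      ring
    rw [this, coeff_C_mul, coeff_mul_X_pow']
    split_ifs <;> simp
  have h5 : ∀ i ∈ Finset.range (s + 1), coeff q ((mk fun n => ((p + m + n).choose (p + m) : ℤ)) *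
      ((-X) ^ i * ((s.choose i : ℕ) : ℤ⟦X⟧) * ((P i : ℤ) : ℤ⟦X⟧))) = _ := fun i _ => h4 i
  simp only [eq_comm (a := q)] at h3
  rw [h3]
  refine (Finset.sum_congr rfl h5).trans ?_
  have h6 : ∀ i, (-1) ^ i * (s.choose i : ℤ) *
        sumProducts ((c : ℤ) - m) (-(i : ℤ)) (-(i : ℤ) + c - 1) *
        sumProducts ((ℓ : ℤ) - p) ((c : ℤ) + 1 - i) ((c : ℤ) + 1 - i + ℓ - 1) *
        ((p + m + (q - i)).choose (p + m) : ℤ) =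
      (-1) ^ i * (s.choose i : ℤ) * P i * ((p + m + (q - i)).choose (p + m) : ℤ) := by
    intro i
    rw [hP]
    ring
  simp only [h6]
  rw [← Finset.sum_filter]
  -- The terms with `s < i ≤ q` vanish with `s.choose i`.
  refine Finset.sum_subset ?_ ?_
  · intro i hi
    simp at hi ⊢
    omega
  · intro i hi hi'
    have : s < i := by
      simp at hi hi'
      omega
    simp [Nat.choose_eq_zero_of_lt this]

end FlaggedWord

/-! ### Partial sizes and `γ` -/

namespace OrderedChainForest

theorem partialSize_succ_of_lt {s : ℕ} (F : OrderedChainForest s) {j : ℕ}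
    (hj : j < F.blocks.length) : F.partialSize j < F.partialSize (j + 1) := by
  have h : F.blocks[j] ≠ [] := F.nonempty_of_mem _ (List.getElem_mem hj)
  unfold partialSize
  rw [List.take_succ_eq_append_getElem hj, List.map_append, List.sum_append]
  simpa using List.length_pos_iff.2 h

theorem partialSize_mono {s : ℕ} (F : OrderedChainForest s) : Monotone F.partialSize := by
  refine monotone_nat_of_le_succ fun j => ?_
  by_cases hj : j < F.blocks.length
  · exact (F.partialSize_succ_of_lt hj).le
  · unfold partialSize
    rw [List.take_of_length_le (by omega), List.take_of_length_le (by omega)]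

/-- Blocks are nonempty, so `j + 1` is the first index whose partial size exceeds `ℓ`. Hence the
position condition forces the value of `γ`. -/
theorem gamma_eq_of_partialSize {s ℓ j : ℕ} (F : OrderedChainForest s) (hj : j < F.blocks.length)
    (h : F.partialSize (j + 1) = ℓ + 1) : F.gamma ℓ = F.blocks.length - j := by
  have hlt := F.partialSize_succ_of_lt hj
  have : (Finset.Icc 1 F.blocks.length).filter (fun i => ℓ < F.partialSize i) =
      Finset.Icc (j + 1) F.blocks.length := by
    ext i
    simp only [Finset.mem_filter, Finset.mem_Icc]
    constructor
    · rintro ⟨⟨-, h2⟩, h3⟩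
      refine ⟨?_, h2⟩
      by_contra hi
      have := F.partialSize_mono (show i ≤ j by omega)
      omega
    · rintro ⟨h1, h2⟩
      have := F.partialSize_mono h1
      omega
  rw [gamma, this, Nat.card_Icc]
  omega

theorem partialSize_eq_length_flatten {s : ℕ} (F : OrderedChainForest s) (j : ℕ) :
    F.partialSize j = (F.blocks.take j).flatten.length := by
  rw [partialSize, List.length_flatten]

end OrderedChainForest

/-! ### Chain forests as triples -/

namespace FlaggedWord

open List OrderedChainForest

/-- The blocks of the chain forest of a triple. -/
def toBlocks (t : List (List ℕ) × List (List ℕ) × List ℕ) : List (List ℕ) :=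
  t.1 ++ t.2.1 ++ [1 :: t.2.2]

theorem flatten_toBlocks_perm (t : List (List ℕ) × List (List ℕ) × List ℕ) :
    (toBlocks t).flatten.Perm (1 :: (t.1.flatten ++ (t.2.2 ++ t.2.1.flatten))) := by
  simp only [toBlocks, flatten_append, flatten_cons, flatten_nil, append_nil]
  refine perm_middle.trans (Perm.cons 1 ?_)
  rw [append_assoc]
  exact perm_append_comm.append_left _

theorem perm_labels_iff {X : List ℕ} {s : ℕ} :
    X.Perm (List.range' 2 s).reverse ↔
      (1 :: X).Nodup ∧ ∀ x, x ∈ 1 :: X ↔ 1 ≤ x ∧ x ≤ s + 1 := by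
  have hmem : ∀ x, x ∈ (List.range' 2 s).reverse ↔ 2 ≤ x ∧ x ≤ s + 1 := by
    intro x
    rw [mem_reverse, mem_range'_1]
    omega
  have hnd : (List.range' 2 s).reverse.Nodup := nodup_reverse.2 nodup_range'
  constructor
  · intro h
    have h1 : ∀ x, x ∈ X ↔ 2 ≤ x ∧ x ≤ s + 1 := fun x => h.mem_iff.trans (hmem x)
    refine ⟨nodup_cons.2 ⟨fun h => ?_, h.nodup_iff.2 hnd⟩, fun x => ?_⟩
    · have := (h1 1).1 h
      omega
    · rw [mem_cons, h1]
      omega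
  · rintro ⟨h1, h2⟩
    rw [nodup_cons] at h1
    refine (perm_ext_iff_of_nodup h1.2 hnd).2 fun x => ?_
    rw [hmem]
    have := h2 x
    rw [mem_cons] at this
    constructor
    · intro hx
      have hx1 : x ≠ 1 := fun h => h1.1 (h ▸ hx)
      have := this.1 (Or.inr hx)
      omega
    · intro hx
      rcases this.2 (by omega) with h | h
      · omega
      · exact h

theorem leader_mem {B : List ℕ} (hB : B ≠ []) : leader B ∈ B := by
  cases B with
  | nil => exact absurd rfl hB
  | cons b t => simp [leader]

theorem isChain_leaders_iff {Bs : List (List ℕ)} (h : ∀ B ∈ Bs, 0 < leader B) :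
    (0 :: Bs.map leader).IsChain (· < ·) ↔ NaturallyOrdered Bs := by
  rw [isChain_iff_pairwise, pairwise_cons, pairwise_map]
  constructor
  · exact fun h => h.2
  · intro h'
    refine ⟨fun x hx => ?_, h'⟩
    obtain ⟨B, hB, rfl⟩ := mem_map.1 hx
    exact h B hB

open Classical in
/-- The triples that correspond to the chain forests in `CF¹`. -/
noncomputable def forestTriples (q s ℓ p m : ℕ) :
    Finset (List (List ℕ) × List (List ℕ) × List ℕ) :=
  {t ∈ (finite_blockTriples (List.range' 2 s).reverse (ℓ + 1)).toFinset |
    ((0 :: (t.1 ++ t.2.1).map leader).IsChain (· < ·) ∧ t.1.length = p + 1 ∧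
      t.2.1.length = m) ∧ tripleWt t = q}

theorem mem_forestTriples {q s ℓ p m : ℕ} {t : List (List ℕ) × List (List ℕ) × List ℕ} :
    t ∈ forestTriples q s ℓ p m ↔
      ((∀ B ∈ t.1 ++ t.2.1, B ≠ []) ∧
        ((toBlocks t).flatten.Nodup ∧
          ∀ x, x ∈ (toBlocks t).flatten ↔ 1 ≤ x ∧ x ≤ s + 1) ∧
        t.1.flatten.length = ℓ + 1) ∧
      (NaturallyOrdered (t.1 ++ t.2.1) ∧ t.1.length = p + 1 ∧ t.2.1.length = m) ∧
        tripleWt t = q := by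
  have hp := flatten_toBlocks_perm t
  have h1 : (t.1.flatten ++ (t.2.2 ++ t.2.1.flatten)).Perm (List.range' 2 s).reverse ↔
      (toBlocks t).flatten.Nodup ∧ ∀ x, x ∈ (toBlocks t).flatten ↔ 1 ≤ x ∧ x ≤ s + 1 := by
    rw [perm_labels_iff, hp.nodup_iff]
    simp only [hp.mem_iff]
  have h2 : (∀ B ∈ t.1 ++ t.2.1, B ≠ []) ↔ (∀ B ∈ t.1, B ≠ []) ∧ ∀ B ∈ t.2.1, B ≠ [] := by
    simp only [mem_append, or_imp, forall_and]
  rw [forestTriples, Finset.mem_filter, Set.Finite.mem_toFinset, blockTriples, Set.mem_ofPred_eq,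
    ← h1, h2, and_assoc (a := ∀ B ∈ t.1, B ≠ []) (b := ∀ B ∈ t.2.1, B ≠ [])]
  refine and_congr_right fun h => and_congr_left fun _ => and_congr_left fun _ => ?_
  refine isChain_leaders_iff fun B hB => ?_
  have hB' : B ≠ [] := h2.2 ⟨h.1, h.2.1⟩ B hB
  refine Nat.pos_of_ne_zero fun h0 => ?_
  have h3 : leader B ∈ (toBlocks t).flatten :=
    mem_flatten.2 ⟨B, by rw [toBlocks]; exact mem_append_left _ hB, leader_mem hB'⟩
  have := ((h1.1 h.2.2.1).2 _).1 h3
  omega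

/-- The shift from `q + 1` to `q` is the leader `1`, which counts in the size of the last block but
not in `tripleWt`. A forest is cut after its first `p + 1` blocks, which have `ℓ + 1` elements. -/
theorem ncard_CFOne (q s ℓ p m : ℕ) :
    (CFOne (q + 1) (s + 1) (p + 1 + m + 1) ℓ (m + 2)).ncard = (forestTriples q s ℓ p m).card := by
  have himage : (fun F : OrderedChainForest (s + 1) => F.blocks) ''
      CFOne (q + 1) (s + 1) (p + 1 + m + 1) ℓ (m + 2) = toBlocks '' (forestTriples q s ℓ p m) := by
    ext b
    constructor
    · rintro ⟨F, ⟨hlen, -, -, hpos, Bs, C, hF, h1, hlead, hsum, hnat⟩, rfl⟩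
      obtain ⟨c, rfl⟩ : ∃ c, C = 1 :: c := by
        cases C with
        | nil => simp at h1
        | cons x c =>
          obtain rfl : x = 1 := hlead
          exact ⟨c, rfl⟩
      have hBs : Bs.length = p + 1 + m := by
        rw [hF] at hlen
        simpa using hlen
      have htb : toBlocks (Bs.take (p + 1), Bs.drop (p + 1), c) = F.blocks := by
        simp [toBlocks, hF]
      refine ⟨(Bs.take (p + 1), Bs.drop (p + 1), c), ?_, htb⟩
      rw [Finset.mem_coe, mem_forestTriples, htb]
      simp only [take_append_drop]
      refine ⟨⟨fun B hB => F.nonempty_of_mem B (by rw [hF]; exact mem_append_left _ hB),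
        ⟨F.nodup, F.mem_iff⟩, ?_⟩, ⟨hnat, by simp; omega, by simp; omega⟩, ?_⟩
      · rw [leaderPosition, show p + 1 + m + 1 - (m + 2) + 2 - 1 = p + 1 by omega,
          partialSize_eq_length_flatten, hF, take_append_of_le_length (by omega)] at hpos
        omega
      · have : (Bs.map wt).sum = ((Bs.take (p + 1)).map wt).sum +
            ((Bs.drop (p + 1)).map wt).sum := by
          rw [← sum_append, ← map_append, take_append_drop]
        simp only [tripleWt]
        simp only [length_cons] at hsum
        omega
    · rintro ⟨⟨A, B, c⟩, ht, rfl⟩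
      rw [Finset.mem_coe, mem_forestTriples] at ht
      obtain ⟨⟨hne, ⟨hnd, hmem⟩, hflat⟩, ⟨hnat, hA, hB⟩, hwt⟩ := ht
      simp only at hne hflat hnat hA hB
      let F : OrderedChainForest (s + 1) := ⟨toBlocks (A, B, c), fun D hD => by
        rw [toBlocks, mem_append] at hD
        rcases hD with hD | hD
        · exact hne D hD
        · rw [mem_singleton] at hD
          rw [hD]
          simp, hnd, hmem⟩
      have hlen : F.blocks.length = p + 1 + m + 1 := by
        simp [F, toBlocks, hA, hB]
        omega
      have hpart : F.partialSize (p + 1) = ℓ + 1 := by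
        rw [partialSize_eq_length_flatten, ← hflat, ← hA]
        simp [F, toBlocks]
      refine ⟨F, ⟨hlen, ?_, by omega, ?_, A ++ B, 1 :: c, rfl, by simp, rfl, ?_, hnat⟩, rfl⟩
      · rw [F.gamma_eq_of_partialSize (by omega) hpart, hlen]
        omega
      · rw [leaderPosition, show p + 1 + m + 1 - (m + 2) + 2 - 1 = p + 1 by omega, hpart]
      · simp only [tripleWt] at hwt
        simp only [map_append, sum_append, length_cons]
        omega
  have hinj : Set.InjOn toBlocks (forestTriples q s ℓ p m : Set _) := by
    rintro ⟨A, B, c⟩ ht ⟨A', B', c'⟩ ht' h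
    rw [Finset.mem_coe, mem_forestTriples] at ht ht'
    have hA : A.length = A'.length := ht.2.1.2.1.trans ht'.2.1.2.1.symm
    simp only [toBlocks, append_assoc] at h
    obtain ⟨rfl, h₁⟩ := append_inj h hA
    obtain ⟨rfl, h₂⟩ := append_inj' h₁ rfl
    simp only [cons.injEq, true_and, and_true] at h₂
    rw [h₂]
  rw [← Set.ncard_image_of_injective _ (fun F G h => OrderedChainForest.ext h :
    Function.Injective (fun F : OrderedChainForest (s + 1) => F.blocks)), himage,
    hinj.ncard_image, Set.ncard_coe_finset]

end FlaggedWord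

theorem theorem5p9 (s k m q ℓ : ℕ) (hm : 1 ≤ m) (hmk : m ≤ k) (hks : k ≤ s) (hℓ : ℓ ≤ s - 1) :
    ((OrderedChainForest.CFOne (q + 1) (s + 1) (k + 1) ℓ (m + 1)).ncard : ℤ) =
        ∑ i ∈ Finset.range (q + 1), (-1 : ℤ) ^ i * (s.choose i : ℤ) *
          sumProducts ((s : ℤ) - ℓ - m) (-(i : ℤ)) ((s : ℤ) - ℓ - 2 - i) *
          sumProducts ((ℓ : ℤ) - ((k : ℤ) - m)) ((s : ℤ) - ℓ - i) ((s : ℤ) - 1 - i) *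
          ((k - 1 + (q - i)).choose (k - 1) : ℤ) ∧
      0 ≤ ∑ i ∈ Finset.range (q + 1), (-1 : ℤ) ^ i * (s.choose i : ℤ) *
          sumProducts ((s : ℤ) - ℓ - m) (-(i : ℤ)) ((s : ℤ) - ℓ - 2 - i) *
          sumProducts ((ℓ : ℤ) - ((k : ℤ) - m)) ((s : ℤ) - ℓ - i) ((s : ℤ) - 1 - i) *
          ((k - 1 + (q - i)).choose (k - 1) : ℤ) := by
  rw [and_iff_left_of_imp (fun h => h ▸ Int.natCast_nonneg _)]
  -- From here on `p + 1` and `m` count the blocks of the two sequences, and `c` the labels other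
  -- than `1` outside the first sequence.
  obtain ⟨m, rfl⟩ : ∃ m', m = m' + 1 := ⟨m - 1, by omega⟩
  obtain ⟨p, rfl⟩ : ∃ p, k = p + 1 + m := ⟨k - (m + 1), by omega⟩
  obtain ⟨c, rfl⟩ : ∃ c, s = ℓ + 1 + c := ⟨s - ℓ - 1, by omega⟩
  have hL : (List.range' 2 (ℓ + 1 + c)).reverse.Pairwise (· > ·) := by
    rw [List.pairwise_reverse]
    exact List.pairwise_lt_range'
  rw [FlaggedWord.ncard_CFOne, FlaggedWord.forestTriples,
    FlaggedWord.card_blockTriples (N := ℓ + 1 + c + 2) (c := c) hL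
      (fun e he => by
        rw [List.mem_reverse, List.mem_range'_1] at he
        omega)
      (by simp) rfl]
  refine Finset.sum_congr rfl fun i _ => ?_
  rw [show p + 1 + m - 1 = p + m by omega]
  push_cast
  rw [show (ℓ : ℤ) + 1 + c - ℓ - (m + 1) = c - m by ring,
    show (ℓ : ℤ) + 1 + c - ℓ - 2 - i = -i + c - 1 by ring,
    show (ℓ : ℤ) - (p + 1 + m - (m + 1)) = ℓ - p by ring,
    show (ℓ : ℤ) + 1 + c - ℓ - i = c + 1 - i by ring,
    show (ℓ : ℤ) + 1 + c - 1 - i = c + 1 - i + ℓ - 1 by ring]
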